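/- \textbf{Setting.} Let $C\ge 1$ be a constant and let $G=(V,E)$ be an undirected, unweighted simple graph on $n\ge 1$ vertices in which every degree lies in $[D/C,\,CD]$, where $D$ is a real number. $G$ is given by its adjacency lists (in arbitrary order, with length queries) and by its adjacency matrix. Time is counted in steps of a randomized random-access machine with zero-initialised arrays. A \emph{$5$-spanner} of $G$ is a subgraph $H\subseteq G$ with $\mathrm{dist}_H(s,t)\le 5\,\mathrm{dist}_G(s,t)$ for all $s,t\in V$. An \emph{adjacency oracle} for $H$ is a data structure that, on query $(s,t)$, deterministically answers in $\widetilde O(1)$ time whether $(s,t)\in E(H)$; it may look up whether $(s,t)\in E(G)$, and it needs no access to $G$ at all if only edges of $G$ are queried. $\log$ is the natural logarithm; $\widetilde O(\cdot)$ hides $O((1+\log n)^{a})$ factors with $a$ absolute and with the implied constant depending only on $C$. \emph{With high probability} means with probability at least $1-n^{-c}$ for an absolute constant $c>0$. \textbf{Construction} (with parameter $r>0$). If $D<n^{1/3}$, the preprocessing does nothing and the oracle answers YES on every edge of $G$. Otherwise the preprocessing is: (1) independently for each $v\in V$, with probability $\min(1,100C\log n/D)$, start a cluster with center $v$; (2)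 for each cluster center $c$ in turn, loop over the edges $(c,w)$; if $w$ is not yet in a cluster, put $w$ into the cluster of $c$ and record the edge $(c,w)$; (3) for each $v\in V$ in turn, sample $\lceil 100Cr\log n\rceil$ incident edges uniformly without replacement (all of them if there are not more); for each sampled edge $(v,w)$ in turn, if $v$ and $w$ are in different clusters and no edge has yet been recorded between these clusters in this step, record that the two clusters are adjacent and record the edge $(v,w)$. On query $(s,t)\in E(G)$ the oracle answers YES if $(s,t)$ was recorded; otherwise it answers NO if $s$ and $t$ are in the same cluster or in two clusters recorded as adjacent; otherwise it answers YES. \textbf{Theorem.} For every $r$ with $0<r\le CD$, with high probability the construction yields an adjacency oracle of a $5$-spanner of $G$ with $\widetilde O\!\left(n+\frac{n^2}{Dr}\right)$ edges, in $\widetilde O(\max(r,1)\,n)$ preprocessing time; that is, in $\widetilde O(rn)$ time when $r\ge 1$. \textbf{Corollary.} With $r=n^{1/3}$ (and no further condition on $D$), with high probability the construction yields an adjacency oracle of a $5$-spanner of $G$ with $\widetilde O(n^{4/3})$ edges, in $\widetilde O(n^{4/3})$ preprocessing time. -/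

import Mathlib

open scoped ENNReal NNReal

namespace SpannerOracle

/-! ### A randomized random-access machine with a step count

A machine word is a natural number. The machine has finitely many registers and finitely many
two-dimensional arrays of words, all initialised to `0`. The only arithmetic is successor,
predecessor and comparison (plus array indexing by a pair of words), so that a program can never
produce words longer than `O(log n)` bits from inputs that are polynomial in `n` in a number of
steps that is polynomial in `n`. The input graph is given both as adjacency lists (with length
queries) and as an adjacency matrix. -/

/-- Registers. -/
inductive Reg
  | s | t | v | w | i | j | a | b
  deriving DecidableEq

/-- Array names. -/
inductive Arr
  | cluster | edge | pair | perm
  deriving DecidableEq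

/-- Memory contents: the registers and the arrays. -/
structure State where
  reg : Reg → ℕ
  arr : Arr → ℕ → ℕ → ℕ

/-- The all-zero memory. -/
def State.init : State := ⟨fun _ => 0, fun _ _ _ => 0⟩

/-- Overwrite register `x` by `k`. -/
def State.set (σ : State) (x : Reg) (k : ℕ) : State :=
  { σ with reg := fun y => if y = x then k else σ.reg y }

/-- Overwrite cell `(p, q)` of array `A` by `k`. -/
def State.put (σ : State) (A : Arr) (p q k : ℕ) : State :=
  { σ with arr := fun B x y => if B = A ∧ x = p ∧ y = q then k else σ.arr B x y }

/-- The queries to an input graph that a program can make: length of the adjacency list of `u`,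
the `i`-th entry of that list, and the entry `(u, v)` of the adjacency matrix. -/
structure GraphAccess where
  deg : ℕ → ℕ
  nbr : ℕ → ℕ → ℕ
  adj : ℕ → ℕ → Bool

/-- No access to any graph: every query is answered by `0`. -/
def GraphAccess.none : GraphAccess := ⟨fun _ => 0, fun _ _ => 0, fun _ _ => false⟩

/-- Word-valued expressions. -/
inductive Expr
  | lit (k : ℕ)
  | reg (x : Reg)
  | succ (e : Expr)
  | pred (e : Expr)
  | get (A : Arr) (e₁ e₂ : Expr)
  | deg (e : Expr)
  | nbr (e₁ e₂ : Expr)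

/-- Boolean conditions. -/
inductive Cond
  | tt
  | eq (e₁ e₂ : Expr)
  | lt (e₁ e₂ : Expr)
  | adj (e₁ e₂ : Expr)
  | not (c : Cond)
  | and (c₁ c₂ : Cond)
  | or (c₁ c₂ : Cond)

/-- Value of an expression. -/
def Expr.eval (Γ : GraphAccess) (σ : State) : Expr → ℕ
  | .lit k => k
  | .reg x => σ.reg x
  | .succ e => e.eval Γ σ + 1
  | .pred e => e.eval Γ σ - 1
  | .get A e₁ e₂ => σ.arr A (e₁.eval Γ σ) (e₂.eval Γ σ)
  | .deg e => Γ.deg (e.eval Γ σ)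
  | .nbr e₁ e₂ => Γ.nbr (e₁.eval Γ σ) (e₂.eval Γ σ)

/-- Number of steps needed to evaluate an expression: one for each node. -/
def Expr.cost : Expr → ℕ
  | .lit _ => 1
  | .reg _ => 1
  | .succ e => e.cost + 1
  | .pred e => e.cost + 1
  | .get _ e₁ e₂ => e₁.cost + e₂.cost + 1
  | .deg e => e.cost + 1
  | .nbr e₁ e₂ => e₁.cost + e₂.cost + 1

/-- Truth value of a condition. -/
def Cond.eval (Γ : GraphAccess) (σ : State) : Cond → Bool
  | .tt => true
  | .eq e₁ e₂ => decide (e₁.eval Γ σ = e₂.eval Γ σ)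
  | .lt e₁ e₂ => decide (e₁.eval Γ σ < e₂.eval Γ σ)
  | .adj e₁ e₂ => Γ.adj (e₁.eval Γ σ) (e₂.eval Γ σ)
  | .not c => !(c.eval Γ σ)
  | .and c₁ c₂ => c₁.eval Γ σ && c₂.eval Γ σ
  | .or c₁ c₂ => c₁.eval Γ σ || c₂.eval Γ σ

/-- Number of steps needed to evaluate a condition: one for each node. -/
def Cond.cost : Cond → ℕ
  | .tt => 1
  | .eq e₁ e₂ => e₁.cost + e₂.cost + 1
  | .lt e₁ e₂ => e₁.cost + e₂.cost + 1
  | .adj e₁ e₂ => e₁.cost + e₂.cost + 1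
  | .not c => c.cost + 1
  | .and c₁ c₂ => c₁.cost + c₂.cost + 1
  | .or c₁ c₂ => c₁.cost + c₂.cost + 1

/-- Randomized programs. -/
inductive Prog
  | skip
  /-- `x := e` -/
  | set (x : Reg) (e : Expr)
  /-- `A[e₁, e₂] := e` -/
  | put (A : Arr) (e₁ e₂ e : Expr)
  | seq (P Q : Prog)
  | ite (c : Cond) (P Q : Prog)
  /-- `for x = 0, ..., e - 1 do P`; the bound `e` is evaluated once -/
  | loop (x : Reg) (e : Expr) (P : Prog)
  /-- `x := 1` with probability `p` (truncated to `[0, 1]`), otherwise `x := 0` -/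
  | flip (x : Reg) (p : ℝ)
  /-- `x :=` a uniformly random element of `{lo, ..., hi - 1}` -/
  | unif (x : Reg) (lo hi : Expr)

/-- A coin with heads probability `p`, truncated to `[0, 1]`. -/
noncomputable def coin (p : ℝ) : PMF Bool :=
  PMF.ofFintype (fun h => if h then ((min p.toNNReal 1 : ℝ≥0) : ℝ≥0∞)
      else ((1 - min p.toNNReal 1 : ℝ≥0) : ℝ≥0∞)) (by
    rw [Fintype.sum_bool]
    simp only [if_true, Bool.false_eq_true, if_false]
    rw [← ENNReal.coe_add, add_tsub_cancel_of_le (min_le_right _ _), ENNReal.coe_one])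

/-- The uniform distribution on `{lo, ..., hi - 1}` (constantly `lo` if this set is empty). -/
noncomputable def unifIco (lo hi : ℕ) : PMF ℕ :=
  if h : (Finset.Ico lo hi).Nonempty then PMF.uniformOfFinset (Finset.Ico lo hi) h
  else PMF.pure lo

/-- Run `body 0`, ..., `body (N - 1)` one after the other, adding up the step counts and one step
for each iteration. -/
noncomputable def iter (body : ℕ → State → PMF (State × ℕ)) : ℕ → State → PMF (State × ℕ)
  | 0, σ => PMF.pure (σ, 0)
  | N + 1, σ => (iter body N σ).bind fun x => (body N x.1).bind fun y =>
      PMF.pure (y.1, x.2 + y.2 + 1)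

/-- `P.run Γ σ` is the joint distribution of the final memory and the number of steps when `P` is
run on input graph `Γ`, starting with memory `σ`. Every program node, expression node, condition
node and loop iteration that is executed costs one step. -/
noncomputable def Prog.run (Γ : GraphAccess) : Prog → State → PMF (State × ℕ)
  | .skip, σ => PMF.pure (σ, 1)
  | .set x e, σ => PMF.pure (σ.set x (e.eval Γ σ), e.cost + 1)
  | .put A e₁ e₂ e, σ =>
      PMF.pure (σ.put A (e₁.eval Γ σ) (e₂.eval Γ σ) (e.eval Γ σ),
        e₁.cost + e₂.cost + e.cost + 1)
  | .seq P Q, σ => (P.run Γ σ).bind fun x => (Q.run Γ x.1).bind fun y =>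
      PMF.pure (y.1, x.2 + y.2 + 1)
  | .ite c P Q, σ => (if c.eval Γ σ then P.run Γ σ else Q.run Γ σ).bind fun x =>
      PMF.pure (x.1, c.cost + x.2 + 1)
  | .loop x e P, σ =>
      (iter (fun k τ => P.run Γ (τ.set x k)) (e.eval Γ σ) σ).bind fun y =>
        PMF.pure (y.1, e.cost + y.2 + 1)
  | .flip x p, σ => (coin p).bind fun h => PMF.pure (σ.set x (if h then 1 else 0), 1)
  | .unif x lo hi, σ => (unifIco (lo.eval Γ σ) (hi.eval Γ σ)).bind fun k =>
      PMF.pure (σ.set x k, lo.cost + hi.cost + 1)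

/-! ### Input graphs, spanners, adjacency oracles -/

/-- Adjacency lists of `G`: the neighbours of every vertex, in an arbitrary order. -/
structure AdjacencyLists {n : ℕ} (G : SimpleGraph (Fin n)) where
  list : Fin n → List (Fin n)
  nodup : ∀ v, (list v).Nodup
  mem_list : ∀ v w, w ∈ list v ↔ G.Adj v w

/-- Query access to `G` through its adjacency lists and its adjacency matrix (queries outside the
vertex set or beyond the end of a list are answered by `0`). -/
def AdjacencyLists.access {n : ℕ} {G : SimpleGraph (Fin n)} [DecidableRel G.Adj]
    (L : AdjacencyLists G) : GraphAccess where
  deg u := if h : u < n then (L.list ⟨u, h⟩).length else 0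
  nbr u i := if h : u < n then (((L.list ⟨u, h⟩)[i]?).map Fin.val).getD 0 else 0
  adj u v := if h : u < n ∧ v < n then decide (G.Adj ⟨u, h.1⟩ ⟨v, h.2⟩) else false

/-- All degrees of `G` are within a factor `C` of `D`. -/
def ApproxRegular {n : ℕ} (G : SimpleGraph (Fin n)) [DecidableRel G.Adj] (C D : ℝ) : Prop :=
  ∀ v, D / C ≤ (G.degree v : ℝ) ∧ (G.degree v : ℝ) ≤ C * D

/-- `H` is a `k`-spanner of `G`. Distances are in `ℕ∞`, with `⊤` between different components. -/
def IsSpanner {V : Type*} (k : ℕ) (G H : SimpleGraph V) : Prop :=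
  H ≤ G ∧ ∀ s t, H.edist s t ≤ k * G.edist s t

/-- Memory `σ` with the two endpoints of a queried pair in the argument registers. -/
def State.withQuery {n : ℕ} (σ : State) (s t : Fin n) : State :=
  (σ.set .s s).set .t t

/-- The query algorithm `q` with a preliminary look-up of the queried pair in the adjacency matrix
of the input graph; non-edges of the input graph are answered NO. -/
def guarded (q : Cond) : Cond := .and (.adj (.reg .s) (.reg .t)) q

/-- The data structure `σ` with query algorithm `q` is an adjacency oracle, with query time at most
`T`, for the subgraph `H` of `G`. Queries are evaluations of a condition, hence deterministic and
without effect on the data structure. The first clause lets the oracle access `G` in order to reject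
non-edges of `G`; by the second clause no access to `G` is needed if only edges of `G` are
queried. -/
def IsAdjacencyOracle {n : ℕ} {G : SimpleGraph (Fin n)} [DecidableRel G.Adj]
    (L : AdjacencyLists G) (q : Cond) (σ : State) (H : SimpleGraph (Fin n)) (T : ℝ) : Prop :=
  (∀ s t, (guarded q).eval L.access (σ.withQuery s t) = true ↔ H.Adj s t) ∧
  (∀ s t, G.Adj s t → (q.eval GraphAccess.none (σ.withQuery s t) = true ↔ H.Adj s t)) ∧
  ((guarded q).cost : ℝ) ≤ T

/-! ### The construction

Vertices are `0, ..., n - 1`. Array contents: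
* `cluster[v, 0]` is `c + 1` if `v` is in the cluster centred at `c`, and `0` if `v` is unclustered;
  the cluster centres are the `v` with `cluster[v, 0] = v + 1`;
* `edge[u, v]` is `1` if the edge `uv` is recorded;
* `pair[c + 1, c' + 1]` is `1` if the clusters centred at `c` and `c'` are recorded as adjacent;
* `perm[v, i]` holds a partially shuffled list of the positions in the adjacency list of `v`, where
  `0` stands for the untouched entry `i` and `k + 1` for the entry `k`. -/

/-- The cluster label of the vertex in register `x`. -/
def label (x : Reg) : Expr := .get .cluster (.reg x) (.lit 0)

/-- Both vertices are clustered. -/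
def bothClustered (x y : Reg) : Cond :=
  .and (.not (.eq (label x) (.lit 0))) (.not (.eq (label y) (.lit 0)))

/-- Record the edge between the vertices in registers `v` and `w`. -/
def recordEdge : Prog :=
  .seq (.put .edge (.reg .v) (.reg .w) (.lit 1)) (.put .edge (.reg .w) (.reg .v) (.lit 1))

/-- First step: every vertex independently becomes a cluster centre with probability `p`. -/
noncomputable def chooseCenters (n : ℕ) (p : ℝ) : Prog :=
  .loop .v (.lit n) (.seq (.flip .b p)
    (.ite (.eq (.reg .b) (.lit 1)) (.put .cluster (.reg .v) (.lit 0) (.succ (.reg .v))) .skip))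

/-- Second step: loop over the edges at every cluster centre `v`; each neighbour `w` that is not yet
in a cluster joins the cluster of `v`, and the edge `vw` is recorded. -/
def assignClusters (n : ℕ) : Prog :=
  .loop .v (.lit n) (.ite (.eq (label .v) (.succ (.reg .v)))
    (.loop .i (.deg (.reg .v)) (.seq (.set .w (.nbr (.reg .v) (.reg .i)))
      (.ite (.eq (label .w) (.lit 0))
        (.seq (.put .cluster (.reg .w) (.lit 0) (.succ (.reg .v))) recordEdge) .skip)))
    .skip)

/-- Given `i < deg v` in registers: the `i`-th draw without replacement from the adjacency list of
`v` (a step of a lazily initialised Fisher-Yates shuffle); the drawn neighbour goes to `w`. -/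
def drawNeighbor : Prog :=
  .seq (.unif .j (.reg .i) (.deg (.reg .v)))
  (.seq (.ite (.eq (.get .perm (.reg .v) (.reg .j)) (.lit 0))
      (.set .a (.reg .j)) (.set .a (.pred (.get .perm (.reg .v) (.reg .j)))))
  (.seq (.ite (.eq (.get .perm (.reg .v) (.reg .i)) (.lit 0))
      (.put .perm (.reg .v) (.reg .j) (.succ (.reg .i)))
      (.put .perm (.reg .v) (.reg .j) (.get .perm (.reg .v) (.reg .i))))
  (.set .w (.nbr (.reg .v) (.reg .a)))))

/-- If `v` and `w` are in different clusters without a recorded edge between them, record that the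
two clusters are adjacent and record the edge `vw`. -/
def recordPair : Prog :=
  .ite (.and (bothClustered .v .w) (.and (.not (.eq (label .v) (label .w)))
      (.not (.eq (.get .pair (label .v) (label .w)) (.lit 1)))))
    (.seq (.put .pair (label .v) (label .w) (.lit 1))
    (.seq (.put .pair (label .w) (label .v) (.lit 1)) recordEdge))
    .skip

/-- Third step: for every vertex `v`, sample `m` incident edges without replacement (all of them if
there are at most `m`) and process them one by one. -/
def sampleEdges (n m : ℕ) : Prog :=
  .loop .v (.lit n) (.loop .i (.lit m)
    (.ite (.lt (.reg .i) (.deg (.reg .v))) (.seq drawNeighbor recordPair) .skip))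

/-- The preprocessing algorithm with parameters `C`, `D` and `r`. If `D < n ^ (1/3)` the input graph
itself is used, and nothing has to be done. -/
noncomputable def preprocess (n : ℕ) (C D r : ℝ) : Prog :=
  if D < (n : ℝ) ^ (1 / 3 : ℝ) then .skip
  else .seq (chooseCenters n (100 * C * Real.log n / D))
    (.seq (assignClusters n) (sampleEdges n ⌈100 * C * r * Real.log n⌉₊))

/-- The cluster-to-cluster query: YES if the edge is recorded; else NO if the endpoints are in the
same cluster or in clusters with a recorded edge between them; else YES. -/
def clusterQuery : Cond :=
  .or (.eq (.get .edge (.reg .s) (.reg .t)) (.lit 1))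
    (.not (.and (bothClustered .s .t) (.or (.eq (label .s) (label .t))
      (.eq (.get .pair (label .s) (label .t)) (.lit 1)))))

/-- The query algorithm; always YES if the input graph itself is used. -/
noncomputable def query (n : ℕ) (D : ℝ) : Cond :=
  if D < (n : ℝ) ^ (1 / 3 : ℝ) then .tt else clusterQuery

/-- The probability that, on input `L`, the construction with parameters `C`, `D`, `r` makes at most
`time` preprocessing steps and ends with an adjacency oracle, with query time at most `queryTime`,
of a `5`-spanner of `G` with at most `edges` edges. -/
noncomputable def successProb {n : ℕ} {G : SimpleGraph (Fin n)} [DecidableRel G.Adj]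
    (L : AdjacencyLists G) (C D r edges time queryTime : ℝ) : ℝ≥0∞ :=
  ((preprocess n C D r).run L.access State.init).toOuterMeasure
    {x | (x.2 : ℝ) ≤ time ∧ ∃ H : SimpleGraph (Fin n), IsSpanner 5 G H ∧
      IsAdjacencyOracle L (query n D) x.1 H queryTime ∧ (H.edgeSet.ncard : ℝ) ≤ edges}

end SpannerOracle

/-! The stretch bound is deterministic. An edge of `G` is rejected only if its ends lie in one
cluster, whose recorded star gives a path of length at most 2, or in two linked clusters, where the
path end, centre, recorded edge, centre, end has length at most 5. All of this follows from the
invariant `ClusterOracle`, which every run preserves; `isSpanner_oracleGraph` draws the conclusion.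

Randomness only affects size and time. A Chernoff bound gives at most `3pn` centres, which is of
order `C n log n / D`, and a vertex of degree at least `D / C` has no centre among its neighbours
with probability at most `n ^ (-100)`. For two clusters `a`, `b` and a vertex `v` in `a` with `h`
neighbours in `b`, a draw at `v` misses `b` with conditional probability at most `1 - h / (C D)`
while the pair is unlinked: sampling is without replacement, and none of the `h` positions has been
used up yet. The factors multiply over all draws, so a pair with `E` crossing edges stays unlinked
with probability at most `exp (-m E / (C D))`, where `m` is the number of draws per vertex. With `m
≥ 100 C r log n`, all pairs with more than `D / r` crossing edges are linked with high probability
(`runExpect_sampleEdges_le`, `runExpect_failure_le`).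

Outside these failures the accepted edges are star edges, one recorded edge per linked pair, and at
most `D / r` edges per unlinked pair (`ncard_oracleGraph_le`). Since `r ≤ C D`, the number of
centres squared times `1 + D / r` is of order `n ^ 2 / (D r)` up to logarithms. If `D < n ^ (1/3)`,
the graph itself is sparse enough.

Two notions carry this over to programs: `Ensures` for properties of every outcome, including the
step count, and `runExpect` for expectations, bounded along loops by potentials. -/

namespace SpannerOracle

/-! ### Expectations and supports of discrete distributions -/

/-- Expectation of a nonnegative function. -/
noncomputable def expect {α : Type*} (μ : PMF α) (f : α → ℝ≥0∞) : ℝ≥0∞ := ∑' x, μ x * f x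

section Expect
variable {α β : Type*}

theorem expect_pure (x : α) (f : α → ℝ≥0∞) : expect (PMF.pure x) f = f x := by
  classical
  unfold expect
  rw [tsum_eq_single x (fun y hy => by simp [PMF.pure_apply, hy])]
  simp [PMF.pure_apply]

theorem expect_bind (μ : PMF α) (κ : α → PMF β) (f : β → ℝ≥0∞) :
    expect (μ.bind κ) f = expect μ fun x => expect (κ x) f := by
  simp only [expect, PMF.bind_apply, ← ENNReal.tsum_mul_right, ← ENNReal.tsum_mul_left, mul_assoc]
  rw [ENNReal.tsum_comm]

theorem expect_mono {μ : PMF α} {f g : α → ℝ≥0∞} (h : ∀ x ∈ μ.support, f x ≤ g x) :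
    expect μ f ≤ expect μ g := by
  refine ENNReal.tsum_le_tsum fun x => ?_
  by_cases hx : μ x = 0
  · simp [hx]
  · gcongr
    exact h x hx

theorem expect_const (μ : PMF α) (k : ℝ≥0∞) : (expect μ fun _ => k) = k := by
  simp [expect, ENNReal.tsum_mul_right, PMF.tsum_coe]

theorem expect_add (μ : PMF α) (f g : α → ℝ≥0∞) :
    (expect μ fun x => f x + g x) = expect μ f + expect μ g := by
  simp [expect, mul_add, ENNReal.tsum_add]

theorem expect_mul_right (μ : PMF α) (f : α → ℝ≥0∞) (k : ℝ≥0∞) :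
    (expect μ fun x => f x * k) = expect μ f * k := by
  simp [expect, ← mul_assoc, ENNReal.tsum_mul_right]

theorem expect_sum {ι : Type*} (s : Finset ι) (μ : PMF α) (f : ι → α → ℝ≥0∞) :
    (expect μ fun x => ∑ i ∈ s, f i x) = ∑ i ∈ s, expect μ (f i) := by
  classical
  induction s using Finset.induction_on with
  | empty => simp [expect]
  | insert i s hi ih => simp [Finset.sum_insert hi, expect_add, ih]

theorem toOuterMeasure_eq_expect (μ : PMF α) (s : Set α) [DecidablePred (· ∈ s)] :
    μ.toOuterMeasure s = expect μ fun x => if x ∈ s then 1 else 0 := by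
  rw [PMF.toOuterMeasure_apply]
  refine tsum_congr fun x => ?_
  by_cases h : x ∈ s <;> simp [h]

/-- A set has probability at least `1 - δ` if its complement has probability at most `δ`. -/
theorem le_toOuterMeasure_of_expect_compl_le {μ : PMF α} {s : Set α} {δ : ℝ≥0∞}
    {f : α → ℝ≥0∞} (hf : ∀ x ∈ μ.support, x ∉ s → 1 ≤ f x) (h : expect μ f ≤ δ) :
    1 - δ ≤ μ.toOuterMeasure s := by
  classical
  rw [toOuterMeasure_eq_expect, tsub_le_iff_right]
  calc (1 : ℝ≥0∞) = expect μ fun _ => 1 := (expect_const μ 1).symm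
    _ ≤ expect μ fun x => (if x ∈ s then 1 else 0) + f x := by
        refine expect_mono fun x hx => ?_
        by_cases hs : x ∈ s
        · simp [hs]
        · simpa [hs] using hf x hx hs
    _ ≤ _ := by rw [expect_add]; gcongr

theorem expect_coin (p : ℝ) (f : Bool → ℝ≥0∞) :
    expect (coin p) f = ((min p.toNNReal 1 : ℝ≥0) : ℝ≥0∞) * f true
      + ((1 - min p.toNNReal 1 : ℝ≥0) : ℝ≥0∞) * f false := by
  rw [expect, tsum_bool, add_comm]
  simp [coin, PMF.ofFintype_apply]

theorem expect_unifIco {lo hi : ℕ} (h : lo < hi) (f : ℕ → ℝ≥0∞) :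
    expect (unifIco lo hi) f = (∑ j ∈ Finset.Ico lo hi, f j) * ((hi - lo : ℕ) : ℝ≥0∞)⁻¹ := by
  have hne : (Finset.Ico lo hi).Nonempty := Finset.nonempty_Ico.2 h
  rw [expect, tsum_eq_sum (s := Finset.Ico lo hi), Finset.sum_mul]
  · refine Finset.sum_congr rfl fun j hj => ?_
    rw [unifIco, dif_pos hne, PMF.uniformOfFinset_apply, if_pos hj, mul_comm]
    simp
  · intro j hj
    rw [unifIco, dif_pos hne, PMF.uniformOfFinset_apply, if_neg hj, zero_mul]

theorem mem_support_unifIco {lo hi j : ℕ} (h : lo < hi) :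
    j ∈ (unifIco lo hi).support ↔ lo ≤ j ∧ j < hi := by
  have hne : (Finset.Ico lo hi).Nonempty := Finset.nonempty_Ico.2 h
  rw [unifIco, dif_pos hne, PMF.mem_support_uniformOfFinset_iff, Finset.mem_Ico]

end Expect

/-! ### Program logic -/

/-- Every possible outcome of `P`, started in `σ`, satisfies `Q`. -/
def Ensures (Γ : GraphAccess) (P : Prog) (σ : State) (Q : State → ℕ → Prop) : Prop :=
  ∀ x ∈ (P.run Γ σ).support, Q x.1 x.2

/-- Expectation of a function of the final memory. -/
noncomputable def runExpect (Γ : GraphAccess) (P : Prog) (σ : State) (f : State → ℝ≥0∞) : ℝ≥0∞ :=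
  expect (P.run Γ σ) fun x => f x.1

section Logic
variable {Γ : GraphAccess} {P R : Prog} {σ : State} {Q Q' : State → ℕ → Prop} {f g : State → ℝ≥0∞}

theorem Ensures.mono (h : Ensures Γ P σ Q) (hQ : ∀ τ t, Q τ t → Q' τ t) : Ensures Γ P σ Q' :=
  fun x hx => hQ _ _ (h x hx)

theorem ensures_skip : Ensures Γ .skip σ Q ↔ Q σ 1 := by
  simp [Ensures, Prog.run]

theorem ensures_set {x : Reg} {e : Expr} :
    Ensures Γ (.set x e) σ Q ↔ Q (σ.set x (e.eval Γ σ)) (e.cost + 1) := by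
  simp [Ensures, Prog.run]

theorem ensures_put {A : Arr} {e₁ e₂ e : Expr} :
    Ensures Γ (.put A e₁ e₂ e) σ Q ↔
      Q (σ.put A (e₁.eval Γ σ) (e₂.eval Γ σ) (e.eval Γ σ)) (e₁.cost + e₂.cost + e.cost + 1) := by
  simp [Ensures, Prog.run]

theorem ensures_seq : Ensures Γ (.seq P R) σ Q ↔
    Ensures Γ P σ fun τ t => Ensures Γ R τ fun τ' t' => Q τ' (t + t' + 1) := by
  simp only [Ensures, Prog.run, PMF.mem_support_bind_iff, PMF.support_pure, Set.mem_singleton_iff]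
  constructor
  · intro h x hx y hy
    exact h (y.1, x.2 + y.2 + 1) ⟨x, hx, y, hy, rfl⟩
  · rintro h _ ⟨x, hx, y, hy, rfl⟩
    exact h x hx y hy

theorem ensures_ite {c : Cond} : Ensures Γ (.ite c P R) σ Q ↔
    if c.eval Γ σ then Ensures Γ P σ fun τ t => Q τ (c.cost + t + 1)
    else Ensures Γ R σ fun τ t => Q τ (c.cost + t + 1) := by
  cases hc : c.eval Γ σ <;>
    simp only [Ensures, Prog.run, PMF.mem_support_bind_iff, PMF.support_pure,
      Set.mem_singleton_iff, hc] <;>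
    constructor
  · intro h x hx
    exact h (x.1, c.cost + x.2 + 1) ⟨x, hx, rfl⟩
  · rintro h _ ⟨x, hx, rfl⟩
    exact h x hx
  · intro h x hx
    exact h (x.1, c.cost + x.2 + 1) ⟨x, hx, rfl⟩
  · rintro h _ ⟨x, hx, rfl⟩
    exact h x hx

theorem ensures_flip {x : Reg} {p : ℝ} (h₁ : Q (σ.set x 1) 1) (h₀ : Q (σ.set x 0) 1) :
    Ensures Γ (.flip x p) σ Q := by
  simp only [Ensures, Prog.run, PMF.mem_support_bind_iff, PMF.support_pure, Set.mem_singleton_iff]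
  rintro _ ⟨b, -, rfl⟩
  cases b
  · exact h₀
  · exact h₁

theorem ensures_unif {x : Reg} {lo hi : Expr} (hlt : lo.eval Γ σ < hi.eval Γ σ)
    (h : ∀ j, lo.eval Γ σ ≤ j → j < hi.eval Γ σ → Q (σ.set x j) (lo.cost + hi.cost + 1)) :
    Ensures Γ (.unif x lo hi) σ Q := by
  simp only [Ensures, Prog.run, PMF.mem_support_bind_iff, PMF.support_pure, Set.mem_singleton_iff]
  rintro _ ⟨j, hj, rfl⟩
  rw [mem_support_unifIco hlt] at hj
  exact h j hj.1 hj.2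

/-- Loop rule for an invariant that involves the number of steps. -/
theorem ensures_loop {x : Reg} {e : Expr} (I : ℕ → State → ℕ → Prop) (h0 : I 0 σ 0)
    (hstep : ∀ k < e.eval Γ σ, ∀ τ t, I k τ t →
      Ensures Γ P (τ.set x k) fun τ' t' => I (k + 1) τ' (t + t' + 1))
    (hQ : ∀ τ t, I (e.eval Γ σ) τ t → Q τ (e.cost + t + 1)) :
    Ensures Γ (.loop x e P) σ Q := by
  have key : ∀ N ≤ e.eval Γ σ,
      ∀ y ∈ (iter (fun k τ => P.run Γ (τ.set x k)) N σ).support, I N y.1 y.2 := by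
    intro N
    induction N with
    | zero => intro _ y hy; simp only [iter, PMF.support_pure, Set.mem_singleton_iff] at hy
              subst hy; exact h0
    | succ N ih =>
      intro hN y hy
      simp only [iter, PMF.mem_support_bind_iff, PMF.support_pure, Set.mem_singleton_iff] at hy
      obtain ⟨z, hz, z', hz', rfl⟩ := hy
      exact hstep N hN z.1 z.2 (ih (by omega) z hz) z' hz'
  simp only [Ensures, Prog.run, PMF.mem_support_bind_iff, PMF.support_pure, Set.mem_singleton_iff]
  rintro _ ⟨y, hy, rfl⟩
  exact hQ _ _ (key _ le_rfl y hy)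

/-- The comparison is needed only on possible outcomes, so invariants proved with `Ensures` can be
used inside expectations. -/
theorem runExpect_mono (hP : Ensures Γ P σ Q) (h : ∀ τ t, Q τ t → f τ ≤ g τ) :
    runExpect Γ P σ f ≤ runExpect Γ P σ g :=
  expect_mono fun x hx => h _ _ (hP x hx)

theorem runExpect_le (hP : Ensures Γ P σ Q) {k : ℝ≥0∞} (h : ∀ τ t, Q τ t → f τ ≤ k) :
    runExpect Γ P σ f ≤ k :=
  (expect_mono fun x hx => h _ _ (hP x hx)).trans (expect_const _ k).le

theorem runExpect_seq : runExpect Γ (.seq P R) σ f = runExpect Γ P σ fun τ => runExpect Γ R τ f := by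
  simp only [runExpect, Prog.run, expect_bind, expect_pure]

theorem runExpect_ite {c : Cond} : runExpect Γ (.ite c P R) σ f =
    if c.eval Γ σ then runExpect Γ P σ f else runExpect Γ R σ f := by
  simp only [runExpect, Prog.run, expect_bind, expect_pure]
  cases c.eval Γ σ <;> rfl

theorem runExpect_flip {x : Reg} {p : ℝ} : runExpect Γ (.flip x p) σ f =
    ((min p.toNNReal 1 : ℝ≥0) : ℝ≥0∞) * f (σ.set x 1)
      + ((1 - min p.toNNReal 1 : ℝ≥0) : ℝ≥0∞) * f (σ.set x 0) := by
  simp [runExpect, Prog.run, expect_bind, expect_pure, expect_coin]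

theorem runExpect_unif {x : Reg} {lo hi : Expr} (h : lo.eval Γ σ < hi.eval Γ σ) :
    runExpect Γ (.unif x lo hi) σ f =
      (∑ j ∈ Finset.Ico (lo.eval Γ σ) (hi.eval Γ σ), f (σ.set x j))
        * ((hi.eval Γ σ - lo.eval Γ σ : ℕ) : ℝ≥0∞)⁻¹ := by
  simp only [runExpect, Prog.run, expect_bind, expect_pure, expect_unifIco h]

/-- Loop rule for a potential that decreases in expectation while an invariant holds. -/
theorem runExpect_loop_le {x : Reg} {e : Expr} (I : ℕ → State → Prop) (F : ℕ → State → ℝ≥0∞)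
    (h0 : I 0 σ)
    (hI : ∀ k < e.eval Γ σ, ∀ τ, I k τ → Ensures Γ P (τ.set x k) fun τ' _ => I (k + 1) τ')
    (hF : ∀ k < e.eval Γ σ, ∀ τ, I k τ → runExpect Γ P (τ.set x k) (F (k + 1)) ≤ F k τ)
    (hf : ∀ τ, I (e.eval Γ σ) τ → f τ ≤ F (e.eval Γ σ) τ) :
    runExpect Γ (.loop x e P) σ f ≤ F 0 σ := by
  have key : ∀ N ≤ e.eval Γ σ,
      (∀ y ∈ (iter (fun k τ => P.run Γ (τ.set x k)) N σ).support, I N y.1) ∧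
      expect (iter (fun k τ => P.run Γ (τ.set x k)) N σ) (fun y => F N y.1) ≤ F 0 σ := by
    intro N
    induction N with
    | zero =>
      intro _
      refine ⟨fun y hy => ?_, by simp [iter, expect_pure]⟩
      simp only [iter, PMF.support_pure, Set.mem_singleton_iff] at hy
      subst hy; exact h0
    | succ N ih =>
      intro hN
      obtain ⟨ih₁, ih₂⟩ := ih (by omega)
      constructor
      · intro y hy
        simp only [iter, PMF.mem_support_bind_iff, PMF.support_pure, Set.mem_singleton_iff] at hy
        obtain ⟨z, hz, z', hz', rfl⟩ := hy
        exact hI N hN z.1 (ih₁ z hz) z' hz'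
      · simp only [iter, expect_bind, expect_pure]
        exact (expect_mono fun z hz => hF N hN z.1 (ih₁ z hz)).trans ih₂
  obtain ⟨h₁, h₂⟩ := key _ le_rfl
  simp only [runExpect, Prog.run, expect_bind, expect_pure]
  exact (expect_mono fun y hy => hf _ (h₁ y hy)).trans h₂

end Logic

/-! ### Memory access -/

@[simp] theorem State.set_arr (σ : State) (x : Reg) (k : ℕ) : (σ.set x k).arr = σ.arr := rfl

@[simp] theorem State.set_reg (σ : State) (x y : Reg) (k : ℕ) :
    (σ.set x k).reg y = if y = x then k else σ.reg y := rfl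

@[simp] theorem State.put_reg (σ : State) (A : Arr) (p q k : ℕ) : (σ.put A p q k).reg = σ.reg := rfl

@[simp] theorem State.put_arr (σ : State) (A B : Arr) (p q k x y : ℕ) :
    (σ.put A p q k).arr B x y = if B = A ∧ x = p ∧ y = q then k else σ.arr B x y := rfl

@[simp] theorem State.init_arr (A : Arr) (x y : ℕ) : State.init.arr A x y = 0 := rfl

/-- The cluster label of a vertex. -/
def State.lab (σ : State) (u : ℕ) : ℕ := σ.arr .cluster u 0

/-- The edge `uw` is recorded. -/
def State.Rec (σ : State) (u w : ℕ) : Prop := σ.arr .edge u w = 1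

/-- The clusters with labels `a` and `b` are recorded as adjacent. -/
def State.Linked (σ : State) (a b : ℕ) : Prop := σ.arr .pair a b = 1

/-- The cluster centres. -/
def State.centers (n : ℕ) (σ : State) : Finset ℕ := (Finset.range n).filter fun u => σ.lab u = u + 1

/-- The queries describe a graph on `0, ..., n - 1`. -/
structure GraphAccess.IsGraph (Γ : GraphAccess) (n : ℕ) : Prop where
  lt : ∀ u w, Γ.adj u w → u < n ∧ w < n
  symm : ∀ u w, Γ.adj u w → Γ.adj w u
  irrefl : ∀ u, ¬ Γ.adj u u
  adj_nbr : ∀ u i, i < Γ.deg u → Γ.adj u (Γ.nbr u i)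
  exists_nbr : ∀ u w, Γ.adj u w → ∃ i < Γ.deg u, Γ.nbr u i = w
  nbr_inj : ∀ u i j, i < Γ.deg u → j < Γ.deg u → Γ.nbr u i = Γ.nbr u j → i = j

theorem AdjacencyLists.isGraph_access {n : ℕ} {G : SimpleGraph (Fin n)} [DecidableRel G.Adj]
    (L : AdjacencyLists G) : L.access.IsGraph n where
  lt u w h := by
    by_contra hn
    simp [AdjacencyLists.access, hn] at h
  symm u w h := by
    simp only [AdjacencyLists.access] at h ⊢
    split_ifs at h with h'
    · simpa [h'.1, h'.2] using (of_decide_eq_true h).symm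
  irrefl u h := by
    simp only [AdjacencyLists.access] at h
    split_ifs at h with h'
    simp at h
  adj_nbr u i h := by
    simp only [AdjacencyLists.access] at h ⊢
    split_ifs at h with hu
    · have := (L.mem_list ⟨u, hu⟩ _).1 (List.getElem_mem h)
      simp [hu, h, this]
    · simp at h
  exists_nbr u w h := by
    simp only [AdjacencyLists.access] at h ⊢
    split_ifs at h with h'
    · obtain ⟨i, hi, he⟩ := List.getElem_of_mem ((L.mem_list _ _).2 (of_decide_eq_true h))
      exact ⟨i, by simpa [h'.1] using hi, by simp [h'.1, hi, he]⟩
  nbr_inj u i j hi hj h := by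
    by_cases hu : u < n
    · simp only [AdjacencyLists.access, hu, dif_pos] at hi hj h
      simp only [hi, hj, List.getElem?_eq_getElem, Option.map_some, Option.getD_some] at h
      exact ((L.nodup ⟨u, hu⟩).getElem_inj_iff).1 (Fin.ext h)
    · simp [AdjacencyLists.access, hu] at hi

theorem AdjacencyLists.access_adj {n : ℕ} {G : SimpleGraph (Fin n)} [DecidableRel G.Adj]
    (L : AdjacencyLists G) (u w : Fin n) : L.access.adj u w = true ↔ G.Adj u w := by
  simp [AdjacencyLists.access]

theorem AdjacencyLists.access_deg {n : ℕ} {G : SimpleGraph (Fin n)} [DecidableRel G.Adj]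
    (L : AdjacencyLists G) (u : Fin n) : L.access.deg u = G.degree u := by
  have h : (L.list u).toFinset = G.neighborFinset u := by
    ext w; simp [L.mem_list]
  simp only [AdjacencyLists.access, Fin.is_lt, dif_pos]
  rw [← List.toFinset_card_of_nodup (L.nodup u), h, SimpleGraph.card_neighborFinset_eq_degree]

/-! ### First step: the random choice of the centres -/

@[simp] theorem State.set_lab (σ : State) (x : Reg) (k u : ℕ) : (σ.set x k).lab u = σ.lab u := rfl

theorem ensures_chooseCenters (Γ : GraphAccess) (n : ℕ) (p : ℝ) :
    Ensures Γ (chooseCenters n p) State.init fun τ t =>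
      (∀ u, τ.lab u = 0 ∨ τ.lab u = u + 1) ∧ (∀ u w, τ.arr .edge u w = 0) ∧
      (∀ u w, τ.arr .pair u w = 0) ∧ (∀ u w, τ.arr .perm u w = 0) ∧ t ≤ 12 * n + 2 := by
  -- One iteration costs at most 12: a body of at most 11 steps, attained when the coin shows heads,
  -- and one step for the loop.
  refine ensures_loop (fun k τ t => (∀ u, τ.lab u = 0 ∨ τ.lab u = u + 1) ∧
      (∀ u w, τ.arr .edge u w = 0) ∧ (∀ u w, τ.arr .pair u w = 0) ∧
      (∀ u w, τ.arr .perm u w = 0) ∧ t ≤ 12 * k)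
    (by simp [State.lab]) ?_ ?_
  · rintro k - τ t ⟨h1, h2, h3, h4, ht⟩
    refine ensures_seq.2 (ensures_flip ?_ ?_) <;>
      simp [ensures_ite, ensures_put, ensures_skip, Cond.eval, Expr.eval, Cond.cost, Expr.cost,
        State.lab, h2, h3, h4] at h1 ⊢
    · refine ⟨fun u => ?_, by omega⟩
      have := h1 u
      split_ifs <;> omega
    · exact ⟨h1, by omega⟩
  · rintro τ t ⟨h1, h2, h3, h4, ht⟩
    simp only [Expr.eval, Expr.cost] at ht ⊢
    exact ⟨h1, h2, h3, h4, by omega⟩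

/-- The events that the vertices are centres are independent and have probability `p`. -/
theorem runExpect_chooseCenters_prod (Γ : GraphAccess) (n : ℕ) (p : ℝ)
    (g : ℕ → Bool → ℝ≥0∞) :
    (runExpect Γ (chooseCenters n p) State.init fun τ =>
      ∏ u ∈ Finset.range n, g u (decide (τ.lab u = u + 1))) ≤
    ∏ u ∈ Finset.range n, (((min p.toNNReal 1 : ℝ≥0) : ℝ≥0∞) * g u true
      + ((1 - min p.toNNReal 1 : ℝ≥0) : ℝ≥0∞) * g u false) := by
  set W : ℕ → ℝ≥0∞ := fun u => ((min p.toNNReal 1 : ℝ≥0) : ℝ≥0∞) * g u true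
      + ((1 - min p.toNNReal 1 : ℝ≥0) : ℝ≥0∞) * g u false with hW
  -- The potential keeps the actual factors of the vertices already decided and replaces the others
  -- by their means `W u`. Undecided labels are still 0, so tails really means "not a centre".
  refine (runExpect_loop_le (fun k τ => ∀ u, k ≤ u → τ.lab u = 0)
    (fun k τ => (∏ u ∈ Finset.range k, g u (decide (τ.lab u = u + 1))) *
      ∏ u ∈ Finset.Ico k n, W u) (by simp [State.lab]) ?_ ?_ ?_).trans ?_
  · intro k _ τ h
    refine ensures_seq.2 (ensures_flip ?_ ?_) <;>
      simp [ensures_ite, ensures_put, ensures_skip, Cond.eval, Expr.eval, State.lab] at h ⊢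
    · intro u hu
      rw [if_neg (by omega)]
      exact h u (by omega)
    · exact fun u hu => h u (by omega)
  · intro k hk τ h
    simp only [Expr.eval] at hk
    simp only [runExpect_seq, runExpect_flip, runExpect_ite, Cond.eval, Expr.eval, State.set_reg,
      if_true, decide_true, Nat.zero_ne_one, decide_false, Bool.false_eq_true, if_false]
    have hput : ∀ (τ' : State) f, runExpect Γ (.put .cluster (.reg .v) (.lit 0)
        (.succ (.reg .v))) τ' f = f (τ'.put .cluster (τ'.reg .v) 0 (τ'.reg .v + 1)) := by
      intro τ' f
      simp [runExpect, Prog.run, expect_pure, Expr.eval]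
    have hskip : ∀ (τ' : State) f, runExpect Γ .skip τ' f = f τ' := by
      intro τ' f
      simp [runExpect, Prog.run, expect_pure]
    rw [hput, hskip, Finset.prod_range_succ, Finset.prod_range_succ,
      Finset.prod_eq_prod_Ico_succ_bot hk]
    have e1 : ∏ u ∈ Finset.range k, g u (decide ((((τ.set .v k).set .b 1).put .cluster
        (((τ.set .v k).set .b 1).reg .v) 0 (((τ.set .v k).set .b 1).reg .v + 1)).lab u = u + 1))
        = ∏ u ∈ Finset.range k, g u (decide (τ.lab u = u + 1)) := by
      refine Finset.prod_congr rfl fun u hu => ?_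
      have : u ≠ k := (Finset.mem_range.1 hu).ne
      congr 2
      simp [State.lab, this]
    have e2 : (((τ.set .v k).set .b 1).put .cluster
        (((τ.set .v k).set .b 1).reg .v) 0 (((τ.set .v k).set .b 1).reg .v + 1)).lab k = k + 1 := by
      simp [State.lab]
    have e3 : ((τ.set .v k).set .b 0).lab k = 0 := by simpa using h k le_rfl
    have e4 : ∏ u ∈ Finset.range k, g u (decide (((τ.set .v k).set .b 0).lab u = u + 1))
        = ∏ u ∈ Finset.range k, g u (decide (τ.lab u = u + 1)) := rfl
    rw [e1, e2, e3, e4, show decide (0 = k + 1) = false by simp]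
    simp only [decide_true, hW]
    exact le_of_eq (by ring)
  · intro τ _
    simp [Expr.eval]
  · simp [hW]

/-! ### Second step: the assignment of the vertices to the clusters -/

/-- The recorded edges are those that join a vertex to the centre of its cluster. -/
structure StarClustering (Γ : GraphAccess) (n : ℕ) (Z : ℕ → Prop) (σ : State) : Prop where
  center_iff : ∀ u, σ.lab u = u + 1 ↔ Z u
  star : ∀ u, σ.lab u ≠ 0 → σ.lab u ≠ u + 1 → ∃ c, σ.lab u = c + 1 ∧ Z c ∧ c < n ∧ σ.Rec c u
  adj : ∀ u w, σ.Rec u w → Γ.adj u w ∧ σ.Rec w u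
  lab_eq : ∀ u w, σ.Rec u w → σ.lab u ≠ 0 ∧ σ.lab u = σ.lab w ∧
    (σ.lab u = w + 1 ∨ σ.lab w = u + 1)
  pair : ∀ a b, σ.arr .pair a b = 0
  perm : ∀ u i, σ.arr .perm u i = 0

/-- Recorded edges have labelled ends, so none touches the unlabelled `w`, and relabelling `w`
cannot spoil an old edge. The new label is not `w + 1`, hence no centre is created. -/
theorem StarClustering.insert {Γ : GraphAccess} {n : ℕ} (hΓ : Γ.IsGraph n) {Z : ℕ → Prop}
    {σ τ : State} (h : StarClustering Γ n Z σ) {k w : ℕ} (hk : Z k) (hkw : Γ.adj k w)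
    (hw : σ.lab w = 0)
    (hτ : ∀ A x y, τ.arr A x y = (((σ.put .cluster w 0 (k + 1)).put .edge k w 1).put
      .edge w k 1).arr A x y) : StarClustering Γ n Z τ := by
  have hne : k ≠ w := by rintro rfl; exact hΓ.irrefl _ hkw
  have hlabk : σ.lab k = k + 1 := (h.center_iff k).2 hk
  have hlab : ∀ u, τ.lab u = if u = w then k + 1 else σ.lab u := by
    intro u; simp [State.lab, hτ]
  have hrec : ∀ u x, τ.Rec u x ↔ (u = w ∧ x = k) ∨ (u = k ∧ x = w) ∨ σ.Rec u x := by
    intro u x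
    simp only [State.Rec, hτ, State.put_arr]
    by_cases c₁ : u = w ∧ x = k
    · simp [c₁]
    · by_cases c₂ : u = k ∧ x = w <;> simp [c₁, c₂]
  have hold : ∀ u x, σ.Rec u x → u ≠ w ∧ x ≠ w := by
    intro u x hux
    have := h.lab_eq u x hux
    constructor <;> rintro rfl <;> omega
  refine ⟨fun u => ?_, fun u h1 h2 => ?_, fun u x hux => ?_, fun u x hux => ?_, ?_, ?_⟩
  · rw [hlab]
    split_ifs with huw
    · subst huw
      rw [← h.center_iff, hw]; omega
    · exact h.center_iff u
  · rw [hlab] at h1 h2 ⊢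
    split_ifs at h1 h2 ⊢ with huw
    · exact ⟨k, rfl, hk, (hΓ.lt _ _ hkw).1, (hrec _ _).2 (by simp [huw])⟩
    · obtain ⟨c, hc, hz, hcn, hr⟩ := h.star u h1 h2
      exact ⟨c, hc, hz, hcn, (hrec _ _).2 (Or.inr (Or.inr hr))⟩
  · rw [hrec] at hux
    rw [hrec]
    rcases hux with ⟨rfl, rfl⟩ | ⟨rfl, rfl⟩ | hux
    · exact ⟨hΓ.symm _ _ hkw, by simp⟩
    · exact ⟨hkw, by simp⟩
    · exact ⟨(h.adj _ _ hux).1, Or.inr (Or.inr (h.adj _ _ hux).2)⟩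
  · rw [hrec] at hux
    rw [hlab, hlab]
    rcases hux with ⟨rfl, rfl⟩ | ⟨rfl, rfl⟩ | hux
    · simp [hne, hlabk]
    · simp [hne, hlabk]
    · rw [if_neg (hold _ _ hux).1, if_neg (hold _ _ hux).2]
      exact h.lab_eq _ _ hux
  · intro a b; simpa [hτ] using h.pair a b
  · intro a b; simpa [hτ] using h.perm a b

theorem StarClustering.congr {Γ : GraphAccess} {n : ℕ} {Z : ℕ → Prop} {σ τ : State}
    (h : StarClustering Γ n Z σ) (hτ : τ.arr = σ.arr) : StarClustering Γ n Z τ := by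
  obtain ⟨r, m⟩ := τ
  obtain ⟨r', m'⟩ := σ
  subst hτ
  exact ⟨h.1, h.2, h.3, h.4, h.5, h.6⟩

/-- The loop tests the current labels, but the set of centres never changes, so it can be frozen as
the set drawn in `σ`. Adjacency lists are scanned only at centres, which is why the time involves
only their degrees. -/
theorem ensures_assignClusters {Γ : GraphAccess} {n : ℕ} (hΓ : Γ.IsGraph n) {σ : State}
    (h1 : ∀ u, σ.lab u = 0 ∨ σ.lab u = u + 1) (h2 : ∀ u w, σ.arr .edge u w = 0)
    (h3 : ∀ u w, σ.arr .pair u w = 0) (h4 : ∀ u w, σ.arr .perm u w = 0) :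
    Ensures Γ (assignClusters n) σ fun τ t =>
      StarClustering Γ n (fun u => σ.lab u = u + 1) τ ∧
      (∀ c < n, σ.lab c = c + 1 → ∀ u, Γ.adj c u → τ.lab u ≠ 0) ∧
      t ≤ 2 + 20 * n + 30 * ∑ c ∈ σ.centers n, Γ.deg c := by
  have hsum : ∀ k, ∑ c ∈ σ.centers (k + 1), Γ.deg c =
      ∑ c ∈ σ.centers k, Γ.deg c + if σ.lab k = k + 1 then Γ.deg k else 0 := by
    intro k
    simp [State.centers, Finset.sum_filter, Finset.sum_range_succ]
  refine ensures_loop (fun k τ t => StarClustering Γ n (fun u => σ.lab u = u + 1) τ ∧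
      (∀ c < k, σ.lab c = c + 1 → ∀ u, Γ.adj c u → τ.lab u ≠ 0) ∧
      t ≤ 20 * k + 30 * ∑ c ∈ σ.centers k, Γ.deg c) ?_ ?_ ?_
  · refine ⟨⟨fun u => Iff.rfl, fun u hu hu' => ?_, ?_, ?_, h3, h4⟩, by simp, by simp⟩
    · exact absurd (h1 u) (by tauto)
    · intro u w h; simp [State.Rec, h2] at h
    · intro u w h; simp [State.Rec, h2] at h
  · rintro k hk τ t ⟨hs, hc, ht⟩
    simp only [Expr.eval] at hk
    rw [ensures_ite]
    have hcond : (Cond.eq (label .v) (.succ (.reg .v))).eval Γ (τ.set .v k)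
        = decide (σ.lab k = k + 1) := by
      exact decide_eq_decide.2 (hs.center_iff k)
    rw [hcond]
    by_cases hz : σ.lab k = k + 1
    swap
    · simp only [hz, decide_false, Bool.false_eq_true, if_false, ensures_skip]
      refine ⟨hs.congr rfl, ?_, ?_⟩
      · intro c hck hcz u hu
        have : c ≠ k := by rintro rfl; exact hz hcz
        exact hc c (by omega) hcz u hu
      · rw [hsum]
        simp [Cond.cost, Expr.cost, label, hz]; omega
    simp only [hz, decide_true, if_true]
    refine ensures_loop (fun i τ' t' => StarClustering Γ n (fun u => σ.lab u = u + 1) τ' ∧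
      τ'.reg .v = k ∧ (∀ c < k, σ.lab c = c + 1 → ∀ u, Γ.adj c u → τ'.lab u ≠ 0) ∧
      (∀ j < i, τ'.lab (Γ.nbr k j) ≠ 0) ∧ t' ≤ 30 * i) ?_ ?_ ?_
    · exact ⟨hs.congr rfl, by simp, hc, by simp, by simp⟩
    · rintro i hi τ' t' ⟨hs', hv, hc', hn, ht'⟩
      simp only [Expr.eval, State.set_reg, if_true] at hi
      have hadj := hΓ.adj_nbr k i hi
      by_cases hw : τ'.lab (Γ.nbr k i) = 0
      · simp [ensures_seq, ensures_set, ensures_ite, ensures_put, recordEdge, Cond.eval, Expr.eval,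
          label, hv, Cond.cost, Expr.cost]
        rw [if_pos (show τ'.arr .cluster (Γ.nbr k i) 0 = 0 from hw)]
        have hlab : ∀ u, τ'.lab u ≠ 0 ∨ u = Γ.nbr k i → State.lab (((((τ'.set .i i).set .w
            (Γ.nbr k i)).put .cluster (Γ.nbr k i) 0 (k + 1)).put .edge k (Γ.nbr k i) 1).put .edge
              (Γ.nbr k i) k 1) u ≠ 0 := by
          intro u hu
          rcases eq_or_ne u (Γ.nbr k i) with h | h
          · simp [State.lab, h]
          · simpa [State.lab, h] using hu
        refine ⟨hs'.insert hΓ (k := k) (w := Γ.nbr k i) hz hadj hw (fun A x y => rfl),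
          fun c hck hcz u hu => hlab u (.inl (hc' c hck hcz u hu)), fun j hj => hlab _ ?_, by omega⟩
        rcases Nat.le_iff_lt_or_eq.1 hj with hj | rfl
        · exact .inl (hn j hj)
        · exact .inr rfl
      · simp [ensures_seq, ensures_set, ensures_ite, ensures_skip, Cond.eval, Expr.eval,
          label, hv, Cond.cost, Expr.cost]
        rw [if_neg (show ¬ τ'.arr .cluster (Γ.nbr k i) 0 = 0 from hw)]
        refine ⟨hs'.congr rfl, fun c hck hcz u hu => hc' c hck hcz u hu, fun j hj => ?_, by omega⟩
        rcases Nat.le_iff_lt_or_eq.1 hj with hj | rfl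
        · exact hn j hj
        · exact hw
    · rintro τ' t' ⟨hs', hv, hc', hn, ht'⟩
      simp only [Expr.eval, State.set_reg, if_true] at hn ht'
      refine ⟨hs', fun c hck hcz u hu => ?_, ?_⟩
      · rcases Nat.lt_succ_iff_lt_or_eq.1 hck with hck | rfl
        · exact hc' c hck hcz u hu
        · obtain ⟨j, hj, rfl⟩ := hΓ.exists_nbr _ _ hu
          exact hn j hj
      · rw [hsum]
        simp [Cond.cost, Expr.cost, label, hz]; omega
  · rintro τ t ⟨hs, hc, ht⟩
    simp only [Expr.eval, Expr.cost] at hc ht ⊢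
    exact ⟨hs, hc, by omega⟩

/-! ### Third step: the invariants -/

/-- The memory describes a clustering with labels `ℓ` in which the star edges of the clusters are
recorded, along with exactly one edge between any two clusters recorded as adjacent. -/
structure ClusterOracle (Γ : GraphAccess) (n : ℕ) (ℓ : ℕ → ℕ) (σ : State) : Prop where
  lab_eq : ∀ u, σ.lab u = ℓ u
  star : ∀ u, ℓ u ≠ 0 → ℓ u ≠ u + 1 → ∃ c, ℓ u = c + 1 ∧ ℓ c = c + 1 ∧ c < n ∧ σ.Rec c u
  adj : ∀ u w, σ.Rec u w → Γ.adj u w ∧ σ.Rec w u ∧ ℓ u ≠ 0 ∧ ℓ w ≠ 0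
  intra : ∀ u w, σ.Rec u w → ℓ u = ℓ w → ℓ u = w + 1 ∨ ℓ w = u + 1
  linked_of_rec : ∀ u w, σ.Rec u w → ℓ u ≠ ℓ w → σ.Linked (ℓ u) (ℓ w)
  unique : ∀ u w u' w', σ.Rec u w → σ.Rec u' w' → ℓ u ≠ ℓ w → ℓ u = ℓ u' → ℓ w = ℓ w' →
    u = u' ∧ w = w'
  rec_of_linked : ∀ a b, σ.Linked a b → a ≠ b ∧ σ.Linked b a ∧
    ∃ u w, ℓ u = a ∧ ℓ w = b ∧ σ.Rec u w

/-- Before sampling every recorded edge lies inside a cluster and no pair is linked, so the clauses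
about pairs of clusters hold vacuously. -/
theorem StarClustering.clusterOracle {Γ : GraphAccess} {n : ℕ} {Z : ℕ → Prop} {σ : State}
    (h : StarClustering Γ n Z σ) : ClusterOracle Γ n σ.lab σ where
  lab_eq _ := rfl
  star u h1 h2 := by
    obtain ⟨c, hc, hz, hcn, hr⟩ := h.star u h1 h2
    exact ⟨c, hc, (h.center_iff c).2 hz, hcn, hr⟩
  adj u w hr := by
    have := h.lab_eq u w hr
    exact ⟨(h.adj u w hr).1, (h.adj u w hr).2, this.1, this.2.1 ▸ this.1⟩
  intra u w hr _ := (h.lab_eq u w hr).2.2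
  linked_of_rec u w hr hne := absurd (h.lab_eq u w hr).2.1 hne
  unique u w _ _ hr _ hne := absurd (h.lab_eq u w hr).2.1 hne
  rec_of_linked a b hl := by simp [State.Linked, h.pair] at hl

/-- Covers the drawing of a neighbour, which writes only registers and the shuffle array. -/
theorem ClusterOracle.congr {Γ : GraphAccess} {n : ℕ} {ℓ : ℕ → ℕ} {σ τ : State}
    (h : ClusterOracle Γ n ℓ σ) (hτ : ∀ A, A ≠ .perm → τ.arr A = σ.arr A) :
    ClusterOracle Γ n ℓ τ := by
  have h1 : ∀ u, τ.lab u = σ.lab u := fun u => by simp [State.lab, hτ]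
  have h2 : ∀ u w, τ.Rec u w ↔ σ.Rec u w := fun u w => by simp [State.Rec, hτ]
  have h3 : ∀ a b, τ.Linked a b ↔ σ.Linked a b := fun a b => by simp [State.Linked, hτ]
  obtain ⟨a1, a2, a3, a4, a5, a6, a7⟩ := h
  constructor <;> simpa only [h1, h2, h3]

theorem ClusterOracle.insert {Γ : GraphAccess} {n : ℕ} (hΓ : Γ.IsGraph n) {ℓ : ℕ → ℕ}
    {σ τ : State} (h : ClusterOracle Γ n ℓ σ) {v w : ℕ} (hvw : Γ.adj v w) (hv : ℓ v ≠ 0)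
    (hw : ℓ w ≠ 0) (hne : ℓ v ≠ ℓ w) (hl : ¬ σ.Linked (ℓ v) (ℓ w))
    (hτ : τ.arr = ((((σ.put .pair (ℓ v) (ℓ w) 1).put .pair (ℓ w) (ℓ v) 1).put .edge v w 1).put
      .edge w v 1).arr) : ClusterOracle Γ n ℓ τ := by
  have hlab : ∀ u, τ.lab u = σ.lab u := fun u => by simp [State.lab, hτ]
  have hrec : ∀ u x, τ.Rec u x ↔ (u = v ∧ x = w) ∨ (u = w ∧ x = v) ∨ σ.Rec u x := by
    intro u x
    simp only [State.Rec, hτ, State.put_arr]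
    by_cases c₁ : u = w ∧ x = v
    · simp [c₁]
    · by_cases c₂ : u = v ∧ x = w <;> simp [c₁, c₂]
  have hlink : ∀ a b, τ.Linked a b ↔
      (a = ℓ v ∧ b = ℓ w) ∨ (a = ℓ w ∧ b = ℓ v) ∨ σ.Linked a b := by
    intro a b
    simp only [State.Linked, hτ, State.put_arr]
    by_cases c₁ : a = ℓ w ∧ b = ℓ v
    · simp [c₁]
    · by_cases c₂ : a = ℓ v ∧ b = ℓ w <;> simp [c₁, c₂]
  have hl' : ¬ σ.Linked (ℓ w) (ℓ v) := fun hl' => hl (h.rec_of_linked _ _ hl').2.1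
  have hwv := hΓ.symm _ _ hvw
  refine ⟨fun u => (hlab u).trans (h.lab_eq u), fun u h1 h2 => ?_, fun u x hux => ?_,
    fun u x hux he => ?_, fun u x hux he => ?_, fun u x u' x' hux hux' h1 h2 h3 => ?_,
    fun a b hab => ?_⟩
  · obtain ⟨c, hc, hz, hcn, hr⟩ := h.star u h1 h2
    exact ⟨c, hc, hz, hcn, (hrec _ _).2 (.inr (.inr hr))⟩
  · rw [hrec] at hux
    rw [hrec]
    rcases hux with ⟨rfl, rfl⟩ | ⟨rfl, rfl⟩ | hux
    · exact ⟨hvw, by simp, hv, hw⟩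
    · exact ⟨hwv, by simp, hw, hv⟩
    · obtain ⟨k1, k2, k3⟩ := h.adj _ _ hux
      exact ⟨k1, .inr (.inr k2), k3⟩
  · rw [hrec] at hux
    rcases hux with ⟨rfl, rfl⟩ | ⟨rfl, rfl⟩ | hux
    · exact absurd he hne
    · exact absurd he.symm hne
    · exact h.intra _ _ hux he
  · rw [hrec] at hux
    rw [hlink]
    rcases hux with ⟨rfl, rfl⟩ | ⟨rfl, rfl⟩ | hux
    · simp
    · simp
    · exact .inr (.inr (h.linked_of_rec _ _ hux he))
  · rw [hrec] at hux hux'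
    -- As the two clusters were unlinked, no older recorded edge joins them; this makes the new edge
    -- the unique one.
    have key : ∀ u x, σ.Rec u x → ℓ u ≠ ℓ x → ¬ (ℓ u = ℓ v ∧ ℓ x = ℓ w) ∧
        ¬ (ℓ u = ℓ w ∧ ℓ x = ℓ v) := by
      intro u x hr hn
      have := h.linked_of_rec _ _ hr hn
      constructor <;> rintro ⟨e1, e2⟩ <;> rw [e1, e2] at this
      · exact hl this
      · exact hl' this
    rcases hux with ⟨rfl, rfl⟩ | ⟨rfl, rfl⟩ | hux <;>
      rcases hux' with ⟨rfl, rfl⟩ | ⟨rfl, rfl⟩ | hux'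
    · simp
    · exact absurd h2 h1
    · exact absurd ⟨h2.symm, h3.symm⟩ (key _ _ hux' (by rwa [← h2, ← h3])).1
    · exact absurd h2 h1
    · simp
    · exact absurd ⟨h2.symm, h3.symm⟩ (key _ _ hux' (by rwa [← h2, ← h3])).2
    · exact absurd ⟨h2, h3⟩ (key _ _ hux h1).1
    · exact absurd ⟨h2, h3⟩ (key _ _ hux h1).2
    · exact h.unique _ _ _ _ hux hux' h1 h2 h3
  · rw [hlink] at hab
    rw [hlink]
    rcases hab with ⟨rfl, rfl⟩ | ⟨rfl, rfl⟩ | hab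
    · exact ⟨hne, by simp, v, w, rfl, rfl, (hrec _ _).2 (by simp)⟩
    · exact ⟨hne.symm, by simp, w, v, rfl, rfl, (hrec _ _).2 (by simp)⟩
    · obtain ⟨k1, k2, u, x, k3, k4, k5⟩ := h.rec_of_linked _ _ hab
      exact ⟨k1, .inr (.inr k2), u, x, k3, k4, (hrec _ _).2 (.inr (.inr k5))⟩

theorem ensures_recordPair {Γ : GraphAccess} {n : ℕ} (hΓ : Γ.IsGraph n) {ℓ : ℕ → ℕ} {σ : State}
    (h : ClusterOracle Γ n ℓ σ) (hvw : Γ.adj (σ.reg .v) (σ.reg .w)) :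
    Ensures Γ recordPair σ fun τ t => ClusterOracle Γ n ℓ τ ∧ τ.arr .perm = σ.arr .perm ∧
      τ.reg = σ.reg ∧ (∀ a b, σ.Linked a b → τ.Linked a b) ∧
      (ℓ (σ.reg .v) ≠ 0 → ℓ (σ.reg .w) ≠ 0 → ℓ (σ.reg .v) ≠ ℓ (σ.reg .w) →
        τ.Linked (ℓ (σ.reg .v)) (ℓ (σ.reg .w))) ∧ t ≤ 61 := by
  have hlab : ∀ u, σ.arr .cluster u 0 = ℓ u := h.lab_eq
  rw [recordPair, ensures_ite]
  set v := σ.reg .v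
  set w := σ.reg .w
  have hc : (Cond.and (bothClustered .v .w) (.and (.not (.eq (label .v) (label .w)))
      (.not (.eq (.get .pair (label .v) (label .w)) (.lit 1))))).eval Γ σ = true ↔
      ℓ v ≠ 0 ∧ ℓ w ≠ 0 ∧ ℓ v ≠ ℓ w ∧ ¬ σ.Linked (ℓ v) (ℓ w) := by
    simp [Cond.eval, bothClustered, label, Expr.eval, hlab, State.Linked, v, w, and_assoc]
  split_ifs with hif
  · obtain ⟨h1, h2, h3, h4⟩ := hc.1 hif
    simp only [ensures_seq, ensures_put, recordEdge, label, Expr.eval, State.put_reg,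
      State.put_arr, hlab, reduceCtorEq, false_and, if_false]
    refine ⟨h.insert hΓ hvw h1 h2 h3 h4 rfl, ?_, trivial, ?_, ?_, ?_⟩
    · funext x y; simp
    · intro a b hab
      simp only [State.Linked, State.put_arr] at hab ⊢
      split_ifs <;> first | rfl | exact hab
    · intro _ _ _
      simp [State.Linked, v, w]
    · simp [Cond.cost, Expr.cost, bothClustered, label]
  · rw [ensures_skip]
    refine ⟨h, rfl, rfl, fun _ _ => id, fun h1 h2 h3 => ?_, ?_⟩
    · by_contra h4
      exact hif (hc.2 ⟨h1, h2, h3, h4⟩)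
    · simp [Cond.cost, Expr.cost, bothClustered, label]

/-- Entry `k` of the partially shuffled list of positions of `v`. -/
def State.shuffled (σ : State) (v k : ℕ) : ℕ :=
  if σ.arr .perm v k = 0 then k else σ.arr .perm v k - 1

/-- The deterministic part of `drawNeighbor`. -/
def takeDrawn : Prog :=
  .seq (.ite (.eq (.get .perm (.reg .v) (.reg .j)) (.lit 0))
      (.set .a (.reg .j)) (.set .a (.pred (.get .perm (.reg .v) (.reg .j)))))
  (.seq (.ite (.eq (.get .perm (.reg .v) (.reg .i)) (.lit 0))
      (.put .perm (.reg .v) (.reg .j) (.succ (.reg .i)))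
      (.put .perm (.reg .v) (.reg .j) (.get .perm (.reg .v) (.reg .i))))
  (.set .w (.nbr (.reg .v) (.reg .a))))

/-- Separates the only random choice from the rest, so that an expectation becomes an average over
`j`. -/
theorem drawNeighbor_eq :
    drawNeighbor = .seq (.unif .j (.reg .i) (.deg (.reg .v))) takeDrawn := rfl

/-- Half a swap suffices: entry `i` is moved to cell `j`, and cell `i` is left stale because later
draws read only cells beyond `i`. -/
theorem ensures_takeDrawn {Γ : GraphAccess} {σ : State} {v i j : ℕ} (hv : σ.reg .v = v)
    (hi : σ.reg .i = i) (hj : σ.reg .j = j) :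
    Ensures Γ takeDrawn σ fun τ t => τ.reg .v = v ∧ τ.reg .w = Γ.nbr v (σ.shuffled v j) ∧
      (∀ A, A ≠ .perm → τ.arr A = σ.arr A) ∧
      (∀ u k, τ.arr .perm u k = if u = v ∧ k = j then
        (if σ.arr .perm v i = 0 then i + 1 else σ.arr .perm v i) else σ.arr .perm u k) ∧
      t ≤ 29 := by
  have harr : ∀ (τ : State) (x y z : ℕ) (A : Arr), A ≠ .perm →
      (τ.put .perm x y z).arr A = τ.arr A := by
    intro τ x y z A hA
    funext p q
    simp [hA]
  by_cases h1 : σ.arr .perm v j = 0 <;> by_cases h2 : σ.arr .perm v i = 0 <;>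
    · simp [takeDrawn, ensures_seq, ensures_ite, ensures_set, ensures_put, Cond.eval, Expr.eval,
        hv, hi, hj, Cond.cost, Expr.cost, State.shuffled, h1, h2]
      intro A hA
      funext p q
      simp [hA]

/-- The loop body of `sampleEdges`. -/
def sampleEdge : Prog := .ite (.lt (.reg .i) (.deg (.reg .v))) (.seq drawNeighbor recordPair) .skip

theorem sampleEdges_eq (n m : ℕ) :
    sampleEdges n m = .loop .v (.lit n) (.loop .i (.lit m) sampleEdge) := rfl

/-- Invariant of the third step. -/
structure Sampling (Γ : GraphAccess) (n : ℕ) (ℓ : ℕ → ℕ) (σ : State) : Prop where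
  oracle : ClusterOracle Γ n ℓ σ
  perm_le : ∀ u k, σ.arr .perm u k ≤ Γ.deg u

theorem Sampling.congr {Γ : GraphAccess} {n : ℕ} {ℓ : ℕ → ℕ} {σ τ : State}
    (h : Sampling Γ n ℓ σ) (hτ : τ.arr = σ.arr) : Sampling Γ n ℓ τ :=
  ⟨h.1.congr fun _ _ => by rw [hτ], by rw [hτ]; exact h.2⟩

/-- A nonzero cell stores a position plus one, so the non-strict bound `perm_le` becomes strict
after decoding. -/
theorem Sampling.shuffled_lt {Γ : GraphAccess} {n : ℕ} {ℓ : ℕ → ℕ} {σ : State}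
    (h : Sampling Γ n ℓ σ) {v k : ℕ} (hk : k < Γ.deg v) : σ.shuffled v k < Γ.deg v := by
  have := h.perm_le v k
  rw [State.shuffled]
  split_ifs <;> omega

theorem ensures_takeDrawn_recordPair {Γ : GraphAccess} {n : ℕ} (hΓ : Γ.IsGraph n) {ℓ : ℕ → ℕ}
    {σ : State} (h : Sampling Γ n ℓ σ) {v i j : ℕ} (hv : σ.reg .v = v) (hi : σ.reg .i = i)
    (hj : σ.reg .j = j) (hij : i ≤ j) (hjd : j < Γ.deg v) :
    Ensures Γ (.seq takeDrawn recordPair) σ fun τ t => Sampling Γ n ℓ τ ∧ τ.reg .v = v ∧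
      (∀ a b, σ.Linked a b → τ.Linked a b) ∧
      (∀ u k, τ.arr .perm u k = if u = v ∧ k = j then
        (if σ.arr .perm v i = 0 then i + 1 else σ.arr .perm v i) else σ.arr .perm u k) ∧
      (ℓ v ≠ 0 → ℓ (Γ.nbr v (σ.shuffled v j)) ≠ 0 → ℓ v ≠ ℓ (Γ.nbr v (σ.shuffled v j)) →
        τ.Linked (ℓ v) (ℓ (Γ.nbr v (σ.shuffled v j)))) ∧ t ≤ 91 := by
  rw [ensures_seq]
  refine (ensures_takeDrawn hv hi hj).mono ?_
  rintro τ t ⟨hτv, hτw, harr, hperm, ht⟩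
  have hadj : Γ.adj (τ.reg .v) (τ.reg .w) := by
    rw [hτv, hτw]
    exact hΓ.adj_nbr _ _ (h.shuffled_lt hjd)
  refine (ensures_recordPair hΓ (h.oracle.congr harr) hadj).mono ?_
  rintro τ' t' ⟨h1, h2, h3, h4, h5, h6⟩
  rw [hτv, hτw] at h5
  refine ⟨⟨h1, fun u k => ?_⟩, by rw [h3, hτv], fun a b hab => h4 a b ?_, ?_, h5, by omega⟩
  · rw [h2, hperm]
    have h7 := h.perm_le v i
    split_ifs with hu
    · rw [hu.1]; omega
    · rw [hu.1]; omega
    · exact h.perm_le u k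
  · simpa [State.Linked, harr] using hab
  · rw [h2]; exact hperm

theorem ensures_sampleEdge {Γ : GraphAccess} {n : ℕ} (hΓ : Γ.IsGraph n) {ℓ : ℕ → ℕ}
    {σ : State} (h : Sampling Γ n ℓ σ) {v i : ℕ} (hv : σ.reg .v = v) (hi : σ.reg .i = i) :
    Ensures Γ sampleEdge σ fun τ t => Sampling Γ n ℓ τ ∧ τ.reg .v = v ∧
      (∀ a b, σ.Linked a b → τ.Linked a b) ∧
      (∀ u k, u ≠ v → τ.arr .perm u k = σ.arr .perm u k) ∧
      (i < Γ.deg v → ∃ j, i ≤ j ∧ j < Γ.deg v ∧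
        (∀ k, τ.arr .perm v k = if k = j then
          (if σ.arr .perm v i = 0 then i + 1 else σ.arr .perm v i) else σ.arr .perm v k) ∧
        (ℓ v ≠ 0 → ℓ (Γ.nbr v (σ.shuffled v j)) ≠ 0 → ℓ v ≠ ℓ (Γ.nbr v (σ.shuffled v j)) →
          τ.Linked (ℓ v) (ℓ (Γ.nbr v (σ.shuffled v j))))) ∧ t ≤ 101 := by
  rw [sampleEdge, ensures_ite]
  simp only [Cond.eval, Expr.eval, hv, hi, decide_eq_true_eq]
  by_cases hid : i < Γ.deg v
  · rw [if_pos hid, drawNeighbor_eq, ensures_seq, ensures_seq]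
    refine ensures_unif (by simpa [Expr.eval, hv, hi] using hid) ?_
    intro j hij hjd
    simp only [Expr.eval, hv, hi] at hij hjd
    have := ensures_takeDrawn_recordPair hΓ (σ := σ.set .j j) (h.congr rfl) (v := v) (i := i)
      (j := j) (by simp [hv]) (by simp [hi]) (by simp) hij hjd
    rw [ensures_seq] at this
    refine this.mono fun τ t h' => h'.mono ?_
    rintro τ' t' ⟨h1, h2, h3, h4, h5, h6⟩
    refine ⟨h1, h2, h3, fun u k hu => by simp [h4, hu], fun _ => ⟨j, hij, hjd, fun k => ?_, h5⟩, ?_⟩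
    · rw [h4]
      simp only [true_and]
      rfl
    · simp [Cond.cost, Expr.cost]; omega
  · rw [if_neg hid, ensures_skip]
    exact ⟨h, hv, fun _ _ => id, fun _ _ _ => rfl, fun h => absurd h hid,
      by simp [Cond.cost, Expr.cost]⟩

/-- The clause on `u ≠ v` guarantees that every later vertex starts with an untouched row of the
shuffle array. -/
theorem ensures_sampleVertex {Γ : GraphAccess} {n : ℕ} (hΓ : Γ.IsGraph n) {ℓ : ℕ → ℕ}
    {σ : State} (h : Sampling Γ n ℓ σ) {v : ℕ} (hv : σ.reg .v = v) (m : ℕ) :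
    Ensures Γ (.loop .i (.lit m) sampleEdge) σ fun τ t => Sampling Γ n ℓ τ ∧
      (∀ a b, σ.Linked a b → τ.Linked a b) ∧
      (∀ u k, u ≠ v → τ.arr .perm u k = σ.arr .perm u k) ∧ t ≤ 102 * m + 2 := by
  refine ensures_loop (fun i τ t => Sampling Γ n ℓ τ ∧ τ.reg .v = v ∧
      (∀ a b, σ.Linked a b → τ.Linked a b) ∧
      (∀ u k, u ≠ v → τ.arr .perm u k = σ.arr .perm u k) ∧ t ≤ 102 * i)
    ⟨h, hv, fun _ _ => id, fun _ _ _ => rfl, by simp⟩ ?_ ?_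
  · rintro i - τ t ⟨h1, h2, h3, h4, h5⟩
    refine (ensures_sampleEdge hΓ (σ := τ.set .i i) (h1.congr rfl) (v := v) (i := i)
      (by simp [h2]) (by simp)).mono ?_
    rintro τ' t' ⟨k1, k2, k3, k4, -, k5⟩
    exact ⟨k1, k2, fun a b hab => k3 a b (h3 a b hab),
      fun u k hu => (k4 u k hu).trans (h4 u k hu), by omega⟩
  · rintro τ t ⟨h1, h2, h3, h4, h5⟩
    simp only [Expr.eval, Expr.cost] at h5 ⊢
    exact ⟨h1, h3, h4, by omega⟩

theorem ensures_sampleEdges {Γ : GraphAccess} {n : ℕ} (hΓ : Γ.IsGraph n) {ℓ : ℕ → ℕ}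
    {σ : State} (h : Sampling Γ n ℓ σ) (m : ℕ) :
    Ensures Γ (sampleEdges n m) σ fun τ t => ClusterOracle Γ n ℓ τ ∧
      t ≤ n * (102 * m + 3) + 2 := by
  rw [sampleEdges_eq]
  refine ensures_loop (fun v τ t => Sampling Γ n ℓ τ ∧ t ≤ v * (102 * m + 3)) ⟨h, by simp⟩ ?_ ?_
  · rintro v - τ t ⟨h1, h2⟩
    refine (ensures_sampleVertex hΓ (σ := τ.set .v v) (h1.congr rfl) (v := v) (by simp) m).mono ?_
    rintro τ' t' ⟨k1, -, -, k2⟩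
    exact ⟨k1, by rw [Nat.succ_mul]; omega⟩
  · rintro τ t ⟨h1, h2⟩
    simp only [Expr.eval, Expr.cost] at h2 ⊢
    exact ⟨h1.oracle, by omega⟩

/-! ### Third step: pairs of clusters with many edges between them are found -/

instance (σ : State) (a b : ℕ) : Decidable (σ.Linked a b) :=
  inferInstanceAs (Decidable (σ.arr .pair a b = 1))

/-- Indicator of the event that two clusters are not recorded as adjacent. -/
noncomputable def unlinked (a b : ℕ) (σ : State) : ℝ≥0∞ := if σ.Linked a b then 0 else 1

/-- The positions in the adjacency list of `v` of the neighbours with label `b`. -/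
def hits (Γ : GraphAccess) (ℓ : ℕ → ℕ) (v b : ℕ) : Finset ℕ :=
  (Finset.range (Γ.deg v)).filter fun x => ℓ (Γ.nbr v x) = b

/-- All positions in `hits Γ ℓ v b` are among those that have not been drawn. -/
def Undrawn (Γ : GraphAccess) (ℓ : ℕ → ℕ) (v b i : ℕ) (σ : State) : Prop :=
  ∀ x ∈ hits Γ ℓ v b, ∃ k, i ≤ k ∧ k < Γ.deg v ∧ σ.shuffled v k = x

theorem unlinked_mono {a b : ℕ} {σ τ : State} (h : σ.Linked a b → τ.Linked a b) :
    unlinked a b τ ≤ unlinked a b σ := by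
  unfold unlinked
  split_ifs <;> simp_all

/-- After a miss, the drawn entry may be forgotten, and the only other entry leaving the range is
that of cell `i`, which survives in cell `j`. -/
theorem Undrawn.step {Γ : GraphAccess} {ℓ : ℕ → ℕ} {v b i j : ℕ} {σ τ : State}
    (h : Undrawn Γ ℓ v b i σ) (hij : i ≤ j) (hjd : j < Γ.deg v)
    (hτ : ∀ k, τ.arr .perm v k = if k = j then
      (if σ.arr .perm v i = 0 then i + 1 else σ.arr .perm v i) else σ.arr .perm v k)
    (hj : σ.shuffled v j ∉ hits Γ ℓ v b) : Undrawn Γ ℓ v b (i + 1) τ := by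
  have h1 : τ.shuffled v j = σ.shuffled v i := by
    simp only [State.shuffled, hτ, if_true]
    split_ifs <;> simp_all
  have h2 : ∀ k, k ≠ j → τ.shuffled v k = σ.shuffled v k := by
    intro k hk
    simp only [State.shuffled, hτ, if_neg hk]
  intro x hx
  obtain ⟨k, hik, hkd, hk⟩ := h x hx
  have hkj : k ≠ j := by rintro rfl; exact hj (hk ▸ hx)
  rcases Nat.eq_or_lt_of_le hik with rfl | hik
  · exact ⟨j, by omega, hjd, h1.trans hk⟩
  · exact ⟨k, hik, hkd, (h2 k hkj).trans hk⟩

/-- The remaining cells surject onto the hits. This lower bound is all that is needed, so the array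
is never shown to hold a permutation. -/
theorem Undrawn.card_le {Γ : GraphAccess} {ℓ : ℕ → ℕ} {v b i : ℕ} {σ : State}
    (h : Undrawn Γ ℓ v b i σ) : (hits Γ ℓ v b).card ≤
      ((Finset.Ico i (Γ.deg v)).filter fun k => σ.shuffled v k ∈ hits Γ ℓ v b).card := by
  refine Finset.card_le_card_of_surjOn (σ.shuffled v) fun x hx => ?_
  obtain ⟨k, h1, h2, h3⟩ := h x hx
  exact ⟨k, by simp only [Finset.coe_filter, Finset.mem_Ico, Set.mem_ofPred_eq]
               exact ⟨⟨h1, h2⟩, h3 ▸ hx⟩, h3⟩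

/-- The chance of missing `s` targets among `N` remaining positions is `1 - s / N ≤ 1 - s / d ≤ exp
(-(s / d))`. -/
theorem natCast_sub_mul_inv_le_exp {s N : ℕ} {d : ℝ} (hs : s ≤ N) (hN : 0 < N) (hd : (N : ℝ) ≤ d) :
    ((N - s : ℕ) : ℝ≥0∞) * (N : ℝ≥0∞)⁻¹ ≤ ENNReal.ofReal (Real.exp (-(s / d))) := by
  have hN' : (0 : ℝ) < N := by exact_mod_cast hN
  rw [← div_eq_mul_inv, ← ENNReal.ofReal_natCast, ← ENNReal.ofReal_natCast,
    ← ENNReal.ofReal_div_of_pos hN', Nat.cast_sub hs]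
  refine ENNReal.ofReal_le_ofReal ?_
  calc ((N : ℝ) - s) / N = 1 - s / N := by field_simp
    _ ≤ 1 - s / d := by gcongr
    _ ≤ _ := by have := Real.add_one_le_exp (-(s / d)); linarith

/-- While the pair is unlinked, all hits are among the `Γ.deg v - i` remaining positions. Having
fewer positions left only helps, so the bound with `d` is uniform in `i`. -/
theorem runExpect_sampleEdge_le {Γ : GraphAccess} {n : ℕ} (hΓ : Γ.IsGraph n) {ℓ : ℕ → ℕ}
    {σ : State} (h : Sampling Γ n ℓ σ) {v i b : ℕ} (hv : σ.reg .v = v) (hi : σ.reg .i = i)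
    (ha : ℓ v ≠ 0) (hb : b ≠ 0) (hab : ℓ v ≠ b) {d : ℝ} (hd : (Γ.deg v : ℝ) ≤ d)
    (hu : ¬ σ.Linked (ℓ v) b → Undrawn Γ ℓ v b i σ) :
    runExpect Γ sampleEdge σ (unlinked (ℓ v) b) ≤
      ENNReal.ofReal (Real.exp (-((hits Γ ℓ v b).card / d))) * unlinked (ℓ v) b σ := by
  by_cases hl : σ.Linked (ℓ v) b
  · refine (runExpect_le (ensures_sampleEdge hΓ h hv hi) (k := 0) ?_).trans zero_le
    rintro τ t ⟨-, -, hmono, -⟩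
    simp [unlinked, hmono _ _ hl]
  have hu := hu hl
  have hcard := hu.card_le
  rw [show unlinked (ℓ v) b σ = 1 by simp [unlinked, hl], mul_one, sampleEdge, runExpect_ite]
  simp only [Cond.eval, Expr.eval, hv, hi, decide_eq_true_eq]
  by_cases hid : i < Γ.deg v
  swap
  -- The list is exhausted although the pair is unlinked: then there were no hits, the exponential
  -- factor is 1, and the bound is trivial.
  · rw [Finset.Ico_eq_empty (by omega), Finset.filter_empty, Finset.card_empty,
      Nat.le_zero] at hcard
    rw [hcard, if_neg hid]
    refine (runExpect_le (ensures_skip (Q := fun _ _ => True).2 trivial) (k := 1) ?_).trans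
      (by simp)
    intro τ _ _
    unfold unlinked
    split_ifs <;> simp
  rw [if_pos hid, drawNeighbor_eq, runExpect_seq, runExpect_seq,
    runExpect_unif (by simpa [Expr.eval, hv, hi] using hid)]
  simp only [Expr.eval, hv, hi, ← runExpect_seq]
  -- Drawing a hit forces the link, so only misses contribute, each at most 1.
  have hsum : ∑ j ∈ Finset.Ico i (Γ.deg v),
      runExpect Γ (takeDrawn.seq recordPair) (σ.set .j j) (unlinked (ℓ v) b) ≤
      ((Γ.deg v - i - (hits Γ ℓ v b).card : ℕ) : ℝ≥0∞) := by
    calc _ ≤ ∑ j ∈ Finset.Ico i (Γ.deg v),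
          (if ¬ σ.shuffled v j ∈ hits Γ ℓ v b then (1 : ℝ≥0∞) else 0) := by
          refine Finset.sum_le_sum fun j hj => ?_
          obtain ⟨hij, hjd⟩ := Finset.mem_Ico.1 hj
          refine runExpect_le (ensures_takeDrawn_recordPair hΓ (σ := σ.set .j j) (h.congr rfl)
            (v := v) (i := i) (j := j) (by simp [hv]) (by simp [hi]) (by simp) hij hjd) ?_
          rintro τ t ⟨-, -, -, -, hrec, -⟩
          have he : (σ.set .j j).shuffled v j = σ.shuffled v j := rfl
          rw [he] at hrec
          by_cases hit : σ.shuffled v j ∈ hits Γ ℓ v b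
          · have hlb := (Finset.mem_filter.1 hit).2
            rw [hlb] at hrec
            simp [unlinked, hrec ha hb hab]
          · rw [if_pos hit, unlinked]
            split_ifs <;> simp
      _ = (((Finset.Ico i (Γ.deg v)).filter fun j => ¬ σ.shuffled v j ∈ hits Γ ℓ v b).card :
            ℝ≥0∞) := by rw [Finset.sum_boole]
      _ ≤ _ := by
          have := Finset.card_filter_add_card_filter_not (s := Finset.Ico i (Γ.deg v))
            (fun k => σ.shuffled v k ∈ hits Γ ℓ v b)
          rw [Nat.card_Ico] at this
          norm_cast
          omega
  have hle : (hits Γ ℓ v b).card ≤ Γ.deg v - i := by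
    have := Finset.card_filter_le (Finset.Ico i (Γ.deg v))
      (fun k => σ.shuffled v k ∈ hits Γ ℓ v b)
    rw [Nat.card_Ico] at this
    omega
  refine (mul_le_mul_left hsum _).trans (natCast_sub_mul_inv_le_exp hle (by omega) ?_)
  refine le_trans ?_ hd
  exact_mod_cast Nat.sub_le _ _

/-- The potential is the indicator of being unlinked times one factor `θ` for each draw to come.
`Undrawn` is required only while the pair is unlinked, because a link makes the potential vanish for
good. -/
theorem runExpect_sampleVertex_le {Γ : GraphAccess} {n : ℕ} (hΓ : Γ.IsGraph n) {ℓ : ℕ → ℕ}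
    {σ : State} (h : Sampling Γ n ℓ σ) {v b : ℕ} (hv : σ.reg .v = v) (m : ℕ)
    (ha : ℓ v ≠ 0) (hb : b ≠ 0) (hab : ℓ v ≠ b) {d : ℝ} (hd : (Γ.deg v : ℝ) ≤ d)
    (hperm : ∀ k, σ.arr .perm v k = 0) :
    runExpect Γ (.loop .i (.lit m) sampleEdge) σ (unlinked (ℓ v) b) ≤
      unlinked (ℓ v) b σ * ENNReal.ofReal (Real.exp (-((hits Γ ℓ v b).card / d))) ^ m := by
  set θ := ENNReal.ofReal (Real.exp (-((hits Γ ℓ v b).card / d)))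
  refine runExpect_loop_le (fun i τ => Sampling Γ n ℓ τ ∧ τ.reg .v = v ∧
      (¬ τ.Linked (ℓ v) b → Undrawn Γ ℓ v b i τ))
    (fun i τ => unlinked (ℓ v) b τ * θ ^ (m - i)) ⟨h, hv, fun _ x hx => ?_⟩ ?_ ?_ ?_
  · exact ⟨x, by simp, Finset.mem_range.1 (Finset.mem_filter.1 hx).1, by simp [State.shuffled, hperm]⟩
  · rintro i - τ ⟨h1, h2, h3⟩
    refine (ensures_sampleEdge hΓ (σ := τ.set .i i) (h1.congr rfl) (v := v) (i := i)
      (by simp [h2]) (by simp)).mono ?_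
    rintro τ' t ⟨k1, k2, k3, k4, k5, -⟩
    refine ⟨k1, k2, fun hl => ?_⟩
    have hl' : ¬ τ.Linked (ℓ v) b := fun hl' => hl (k3 _ _ hl')
    have hun := h3 hl'
    by_cases hid : i < Γ.deg v
    · obtain ⟨j, hij, hjd, hk, hrec⟩ := k5 hid
      refine hun.step hij hjd hk fun hit => hl ?_
      have hlb := (Finset.mem_filter.1 hit).2
      have he : (τ.set .i i).shuffled v j = τ.shuffled v j := rfl
      rw [he, hlb] at hrec
      exact hrec ha hb hab
    · intro x hx
      obtain ⟨k, e1, e2, -⟩ := hun x hx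
      omega
  · rintro i hi τ ⟨h1, h2, h3⟩
    simp only [Expr.eval] at hi
    have e : m - i = m - (i + 1) + 1 := by omega
    have := runExpect_sampleEdge_le hΓ (σ := τ.set .i i) (h1.congr rfl) (v := v) (i := i)
      (by simp [h2]) (by simp) ha hb hab hd h3
    calc runExpect Γ sampleEdge (τ.set .i i) (fun τ => unlinked (ℓ v) b τ * θ ^ (m - (i + 1)))
        = runExpect Γ sampleEdge (τ.set .i i) (unlinked (ℓ v) b) * θ ^ (m - (i + 1)) :=
          expect_mul_right _ _ _
      _ ≤ (θ * unlinked (ℓ v) b τ) * θ ^ (m - (i + 1)) := by gcongr; exact this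
      _ = _ := by rw [e, pow_succ]; ring
  · intro τ _
    simp [Expr.eval]

/-- The number of ordered edges from cluster `a` to cluster `b`. -/
def crossing (Γ : GraphAccess) (n : ℕ) (ℓ : ℕ → ℕ) (a b : ℕ) : ℕ :=
  ∑ v ∈ Finset.range n, if ℓ v = a then (hits Γ ℓ v b).card else 0

/-- Only draws at vertices of cluster `a` are exploited; other vertices can only create links. The
exponents of the vertices of `a` add up to the number of crossing edges. -/
theorem runExpect_sampleEdges_le {Γ : GraphAccess} {n : ℕ} (hΓ : Γ.IsGraph n) {ℓ : ℕ → ℕ}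
    {σ : State} (h : Sampling Γ n ℓ σ) (hperm : ∀ u k, σ.arr .perm u k = 0) (m : ℕ) {a b : ℕ}
    (ha : a ≠ 0) (hb : b ≠ 0) (hab : a ≠ b) {d : ℝ} (hd : ∀ v < n, (Γ.deg v : ℝ) ≤ d) :
    runExpect Γ (sampleEdges n m) σ (unlinked a b) ≤
      ENNReal.ofReal (Real.exp (-(m * crossing Γ n ℓ a b / d))) := by
  set W : ℕ → ℝ≥0∞ := fun v =>
    ENNReal.ofReal (Real.exp (-(((if ℓ v = a then (hits Γ ℓ v b).card else 0 : ℕ) : ℝ) / d))) ^ m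
    with hW
  rw [sampleEdges_eq]
  refine (runExpect_loop_le (fun v τ => Sampling Γ n ℓ τ ∧ ∀ u k, v ≤ u → τ.arr .perm u k = 0)
    (fun v τ => unlinked a b τ * ∏ u ∈ Finset.Ico v n, W u) ⟨h, fun u k _ => hperm u k⟩
    ?_ ?_ ?_).trans ?_
  · rintro v - τ ⟨h1, h2⟩
    refine (ensures_sampleVertex hΓ (σ := τ.set .v v) (h1.congr rfl) (v := v) (by simp) m).mono ?_
    rintro τ' t ⟨k1, -, k3, -⟩
    exact ⟨k1, fun u k hu => (k3 u k (by omega)).trans (h2 u k (by omega))⟩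
  · rintro v hv τ ⟨h1, h2⟩
    simp only [Expr.eval] at hv
    have key : runExpect Γ (.loop .i (.lit m) sampleEdge) (τ.set .v v) (unlinked a b) ≤
        unlinked a b τ * W v := by
      by_cases hva : ℓ v = a
      · subst hva
        simp only [hW, if_true]
        exact runExpect_sampleVertex_le hΓ (σ := τ.set .v v) (h1.congr rfl) (v := v)
          (by simp) m ha hb hab (hd v hv) (fun k => h2 v k le_rfl)
      · refine (runExpect_le (ensures_sampleVertex hΓ (σ := τ.set .v v) (h1.congr rfl) (v := v)
          (by simp) m) (k := unlinked a b τ) ?_).trans (by simp [hW, hva])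
        rintro τ' t ⟨-, k2, -⟩
        exact unlinked_mono (k2 a b)
    calc runExpect Γ (.loop .i (.lit m) sampleEdge) (τ.set .v v)
          (fun τ => unlinked a b τ * ∏ u ∈ Finset.Ico (v + 1) n, W u)
        = runExpect Γ (.loop .i (.lit m) sampleEdge) (τ.set .v v) (unlinked a b) *
            ∏ u ∈ Finset.Ico (v + 1) n, W u := expect_mul_right _ _ _
      _ ≤ (unlinked a b τ * W v) * ∏ u ∈ Finset.Ico (v + 1) n, W u := by gcongr
      _ = _ := by rw [Finset.prod_eq_prod_Ico_succ_bot hv, mul_assoc]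
  · intro τ _
    simp [Expr.eval]
  · have h1 : unlinked a b σ ≤ 1 := by unfold unlinked; split_ifs <;> simp
    refine (mul_le_mul_left h1 _).trans ?_
    rw [one_mul, ← Finset.range_eq_Ico, Finset.prod_pow,
      ← ENNReal.ofReal_prod_of_nonneg (fun _ _ => (Real.exp_pos _).le), ← Real.exp_sum,
      ← ENNReal.ofReal_pow (Real.exp_pos _).le, ← Real.exp_nat_mul]
    refine ENNReal.ofReal_le_ofReal (Real.exp_le_exp.2 (le_of_eq ?_))
    rw [crossing, Finset.sum_neg_distrib, ← Finset.sum_div]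
    push_cast
    ring

/-! ### The spanner described by the memory -/

/-- The stretch need only be checked on edges: add the bounds along a shortest walk. For unreachable
pairs, `k ≠ 0` makes the right side `⊤`. -/
theorem edist_le_mul_edist {V : Type*} {G H : SimpleGraph V} {k : ℕ} (hk : k ≠ 0)
    (h : ∀ s t, G.Adj s t → H.edist s t ≤ k) (s t : V) : H.edist s t ≤ k * G.edist s t := by
  by_cases hst : G.Reachable s t
  · obtain ⟨p, hp⟩ := hst.exists_walk_length_eq_edist
    rw [← hp]
    clear hp hst
    induction p with
    | nil => simp
    | @cons u v w huv p ih =>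
      calc H.edist u w ≤ H.edist u v + H.edist v w := SimpleGraph.edist_triangle
        _ ≤ k + k * (p.length : ℕ∞) := add_le_add (h _ _ huv) ih
        _ = _ := by rw [SimpleGraph.Walk.length_cons]; push_cast; ring
  · rw [SimpleGraph.edist_eq_top_of_not_reachable hst, ENat.mul_top (by exact_mod_cast hk)]
    exact le_top

/-- Edges are bounded by ordered pairs; the lost factor 2 is harmless and avoids work in `Sym2`. -/
theorem ncard_edgeSet_le {V : Type*} [Fintype V] (H : SimpleGraph V)
    [DecidableRel H.Adj] :
    H.edgeSet.ncard ≤ (Finset.univ.filter fun p : V × V => H.Adj p.1 p.2).card := by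
  classical
  have hsub : H.edgeSet ⊆
      ((Finset.univ.filter fun p : V × V => H.Adj p.1 p.2).image fun p => s(p.1, p.2) :
        Finset (Sym2 V)) := by
    intro e
    induction e with
    | _ x y =>
      intro hxy
      simp only [Finset.coe_image, Set.mem_image]
      exact ⟨(x, y), by simpa using hxy, rfl⟩
  refine (Set.ncard_le_ncard hsub (Finset.finite_toSet _)).trans ?_
  rw [Set.ncard_coe_finset]
  exact Finset.card_image_le

theorem IsSpanner.refl {V : Type*} (G : SimpleGraph V) {k : ℕ} (hk : k ≠ 0) : IsSpanner k G G := by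
  refine ⟨le_rfl, edist_le_mul_edist hk fun s t hst => ?_⟩
  rw [SimpleGraph.edist_eq_one_iff_adj.2 hst]
  exact_mod_cast Nat.one_le_iff_ne_zero.2 hk

section Spanner
variable {n : ℕ} {G : SimpleGraph (Fin n)} [DecidableRel G.Adj] {L : AdjacencyLists G}
  {ℓ : ℕ → ℕ} {σ : State}

/-- Stated for an arbitrary `Γ`, since the query never consults the graph; this yields both clauses
of `IsAdjacencyOracle`. -/
theorem ClusterOracle.eval_clusterQuery (h : ClusterOracle L.access n ℓ σ) (Γ : GraphAccess)
    (s t : Fin n) : clusterQuery.eval Γ (σ.withQuery s t) = true ↔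
      σ.Rec s t ∨ ¬ (ℓ s ≠ 0 ∧ ℓ t ≠ 0 ∧ (ℓ s = ℓ t ∨ σ.Linked (ℓ s) (ℓ t))) := by
  have hlab : ∀ u, σ.arr .cluster u 0 = ℓ u := h.lab_eq
  simp only [clusterQuery, Cond.eval, bothClustered, label, Expr.eval, State.withQuery,
    State.set_reg, State.set_arr, reduceCtorEq, if_false, if_true, hlab, State.Rec, State.Linked,
    Bool.or_eq_true, Bool.not_eq_true', Bool.and_eq_false_iff, decide_eq_true_eq,
    Bool.not_eq_false', Bool.or_eq_false_iff, decide_eq_false_iff_not]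
  tauto

/-- The subgraph of `G` described by the memory `σ`. -/
def oracleGraph (G : SimpleGraph (Fin n)) (ℓ : ℕ → ℕ) (σ : State)
    (h : ClusterOracle L.access n ℓ σ) : SimpleGraph (Fin n) where
  Adj s t := G.Adj s t ∧
    (σ.Rec s t ∨ ¬ (ℓ s ≠ 0 ∧ ℓ t ≠ 0 ∧ (ℓ s = ℓ t ∨ σ.Linked (ℓ s) (ℓ t))))
  symm := ⟨by
    rintro s t ⟨hst, hq⟩
    refine ⟨hst.symm, ?_⟩
    rcases hq with hq | hq
    · exact .inl (h.adj _ _ hq).2.1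
    · refine .inr fun ⟨h1, h2, h3⟩ => hq ⟨h2, h1, ?_⟩
      exact h3.imp Eq.symm fun h3 => (h.rec_of_linked _ _ h3).2.1⟩
  loopless := ⟨fun s hs => hs.1.ne rfl⟩

theorem oracleGraph_adj_of_rec (h : ClusterOracle L.access n ℓ σ) {s t : Fin n}
    (hst : σ.Rec s t) : (oracleGraph G ℓ σ h).Adj s t :=
  ⟨(L.access_adj s t).1 (h.adj _ _ hst).1, .inl hst⟩

theorem isAdjacencyOracle_oracleGraph (h : ClusterOracle L.access n ℓ σ) :
    IsAdjacencyOracle L clusterQuery σ (oracleGraph G ℓ σ h) (guarded clusterQuery).cost := by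
  refine ⟨fun s t => ?_, fun s t hst => ?_, le_rfl⟩
  · rw [guarded, Cond.eval, Bool.and_eq_true, h.eval_clusterQuery]
    simp only [Cond.eval, Expr.eval, State.withQuery, State.set_reg, if_true, reduceCtorEq,
      if_false, L.access_adj]
    rfl
  · rw [h.eval_clusterQuery]
    exact (and_iff_right hst).symm

theorem edist_center_le (h : ClusterOracle L.access n ℓ σ) {u c : Fin n} (hu : ℓ u = c + 1) :
    (oracleGraph G ℓ σ h).edist c u ≤ 1 := by
  by_cases hc : (c : ℕ) = u
  · rw [Fin.ext hc, SimpleGraph.edist_self]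
    exact zero_le
  · obtain ⟨c', h1, -, -, h4⟩ := h.star u (by omega) (by omega)
    have : c' = c := by omega
    subst this
    exact (SimpleGraph.edist_eq_one_iff_adj.2 (oracleGraph_adj_of_rec h h4)).le

theorem exists_center (h : ClusterOracle L.access n ℓ σ) {u : Fin n} (hu : ℓ u ≠ 0) :
    ∃ c : Fin n, ℓ u = c + 1 ∧ ℓ c = c + 1 := by
  by_cases hc : ℓ u = u + 1
  · exact ⟨u, hc, hc⟩
  · obtain ⟨c, h1, h2, h3, -⟩ := h.star u hu hc
    exact ⟨⟨c, h3⟩, h1, h2⟩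

/-- A rejected edge `st` is replaced by `s, c, t` within a cluster, or by `s, c, x, y, d, t` with
`xy` the edge recorded for the two clusters. -/
theorem isSpanner_oracleGraph (h : ClusterOracle L.access n ℓ σ) :
    IsSpanner 5 G (oracleGraph G ℓ σ h) := by
  set H := oracleGraph G ℓ σ h with hH
  refine ⟨fun s t hst => hst.1, edist_le_mul_edist (by norm_num) fun s t hst => ?_⟩
  by_cases hadj : H.Adj s t
  · rw [SimpleGraph.edist_eq_one_iff_adj.2 hadj]
    norm_num
  have hq : ℓ s ≠ 0 ∧ ℓ t ≠ 0 ∧ (ℓ s = ℓ t ∨ σ.Linked (ℓ s) (ℓ t)) := by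
    by_contra hq
    exact hadj ⟨hst, .inr hq⟩
  obtain ⟨hs, ht, hq⟩ := hq
  obtain ⟨c, hc, -⟩ := exists_center h hs
  obtain ⟨d, hd, -⟩ := exists_center h ht
  have h1 : H.edist s c ≤ 1 := SimpleGraph.edist_comm.trans_le (edist_center_le h hc)
  have h5 : H.edist d t ≤ 1 := edist_center_le h hd
  rcases hq with hq | hq
  · have : d = c := Fin.ext (by omega)
    subst this
    calc H.edist s t ≤ H.edist s d + H.edist d t := SimpleGraph.edist_triangle
      _ ≤ 1 + 1 := add_le_add h1 h5
      _ ≤ _ := by norm_num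
  · obtain ⟨-, -, x, y, hx, hy, hxy⟩ := h.rec_of_linked _ _ hq
    obtain ⟨hxn, hyn⟩ := L.isGraph_access.lt _ _ (h.adj _ _ hxy).1
    have h2 : H.edist c ⟨x, hxn⟩ ≤ 1 := edist_center_le h (u := ⟨x, hxn⟩) (hx.trans hc)
    have h3 : H.edist ⟨x, hxn⟩ ⟨y, hyn⟩ ≤ 1 :=
      (SimpleGraph.edist_eq_one_iff_adj.2 (oracleGraph_adj_of_rec h hxy)).le
    have h4 : H.edist ⟨y, hyn⟩ d ≤ 1 :=
      SimpleGraph.edist_comm.trans_le (edist_center_le h (u := ⟨y, hyn⟩) (hy.trans hd))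
    calc H.edist s t ≤ H.edist s c + (H.edist c ⟨x, hxn⟩ + (H.edist ⟨x, hxn⟩ ⟨y, hyn⟩ +
          (H.edist ⟨y, hyn⟩ d + H.edist d t))) := by
          refine SimpleGraph.edist_triangle.trans (add_le_add_right ?_ _)
          refine SimpleGraph.edist_triangle.trans (add_le_add_right ?_ _)
          refine SimpleGraph.edist_triangle.trans (add_le_add_right ?_ _)
          exact SimpleGraph.edist_triangle
      _ ≤ 1 + (1 + (1 + (1 + 1))) := by gcongr
      _ ≤ _ := by norm_num

/-- `crossing` counts positions in adjacency lists, as the sampler sees them; every adjacent pair of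
vertices comes from such a position. -/
theorem card_crossing_le (Γ : GraphAccess) (hΓ : Γ.IsGraph n) (a b : ℕ) (S : Finset (Fin n × Fin n))
    (hS : ∀ p ∈ S, Γ.adj p.1 p.2 ∧ ℓ p.1 = a ∧ ℓ p.2 = b) : S.card ≤ crossing Γ n ℓ a b := by
  classical
  have hcr : crossing Γ n ℓ a b =
      (((Finset.range n).filter fun v => ℓ v = a).sigma fun v => hits Γ ℓ v b).card := by
    rw [Finset.card_sigma, Finset.sum_filter, crossing]
  rw [hcr]
  have hinj : Function.Injective fun p : Fin n × Fin n => ((p.1 : ℕ), (p.2 : ℕ)) := by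
    rintro ⟨x, y⟩ ⟨x', y'⟩ he
    simpa [Prod.ext_iff, Fin.ext_iff] using he
  rw [← Finset.card_image_of_injective S hinj]
  refine (Finset.card_le_card ?_).trans
    (Finset.card_image_le (f := fun q : (_ : ℕ) × ℕ => (q.1, Γ.nbr q.1 q.2)))
  intro q hq
  obtain ⟨p, hp, rfl⟩ := Finset.mem_image.1 hq
  obtain ⟨h1, h2, h3⟩ := hS p hp
  obtain ⟨i, hi, he⟩ := hΓ.exists_nbr _ _ h1
  refine Finset.mem_image.2 ⟨⟨p.1, i⟩, ?_, by simp [he]⟩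
  simp only [Finset.mem_sigma, Finset.mem_filter, Finset.mem_range, hits]
  exact ⟨⟨p.1.2, h2⟩, hi, by rw [he, h3]⟩

/-- With all vertices clustered, an accepted ordered pair is a star edge (`A₁`, `A₂`, at most `n`
each), a recorded edge between clusters (`B`, one per pair of labels), or an edge between unlinked
clusters (`E`, at most `M` per pair of labels). -/
theorem ncard_oracleGraph_le (h : ClusterOracle L.access n ℓ σ) (hall : ∀ u < n, ℓ u ≠ 0)
    {M : ℝ} (hM : 0 ≤ M) (hlink : ∀ a ∈ Finset.Icc 1 n, ∀ b ∈ Finset.Icc 1 n, a ≠ b →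
      M < crossing L.access n ℓ a b → σ.Linked a b) :
    ((oracleGraph G ℓ σ h).edgeSet.ncard : ℝ) ≤
      2 * n + ((σ.centers n).card : ℝ) ^ 2 * (1 + M) := by
  classical
  set H := oracleGraph G ℓ σ h
  set T := (σ.centers n).image (· + 1) with hT
  have hTcard : T.card ≤ (σ.centers n).card := Finset.card_image_le
  have hTn : ∀ a ∈ T, a ∈ Finset.Icc 1 n := by
    intro a ha
    obtain ⟨c, hc, rfl⟩ := Finset.mem_image.1 ha
    have := (Finset.mem_filter.1 hc).1
    simp only [Finset.mem_range, Finset.mem_Icc] at this ⊢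
    omega
  have hmem : ∀ u : Fin n, ℓ u ∈ T := by
    intro u
    obtain ⟨c, h1, h2⟩ := exists_center h (hall u u.2)
    exact Finset.mem_image.2 ⟨c, by simp [State.centers, h.lab_eq, h2], h1.symm⟩
  let A₁ := Finset.univ.filter fun p : Fin n × Fin n => ℓ p.1 = p.2 + 1
  let A₂ := Finset.univ.filter fun p : Fin n × Fin n => ℓ p.2 = p.1 + 1
  let B := Finset.univ.filter fun p : Fin n × Fin n => σ.Rec p.1 p.2 ∧ ℓ p.1 ≠ ℓ p.2
  let E := Finset.univ.filter fun p : Fin n × Fin n =>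
    G.Adj p.1 p.2 ∧ ℓ p.1 ≠ ℓ p.2 ∧ ¬ σ.Linked (ℓ p.1) (ℓ p.2)
  have hA₁ : A₁.card ≤ n := by
    have : A₁.card ≤ (Finset.univ : Finset (Fin n)).card := by
      refine Finset.card_le_card_of_injOn Prod.fst (fun _ _ => Finset.mem_coe.2 (Finset.mem_univ _)) ?_
      rintro ⟨x, y⟩ hp ⟨x', y'⟩ hp' he
      simp only [A₁, Finset.coe_filter, Finset.mem_univ, true_and, Set.mem_ofPred_eq] at hp hp' he
      subst he
      exact Prod.ext rfl (Fin.ext (Nat.succ_injective (hp.symm.trans hp')))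
    simpa using this
  have hA₂ : A₂.card ≤ n := by
    have : A₂.card ≤ (Finset.univ : Finset (Fin n)).card := by
      refine Finset.card_le_card_of_injOn Prod.snd (fun _ _ => Finset.mem_coe.2 (Finset.mem_univ _)) ?_
      rintro ⟨x, y⟩ hp ⟨x', y'⟩ hp' he
      simp only [A₂, Finset.coe_filter, Finset.mem_univ, true_and, Set.mem_ofPred_eq] at hp hp' he
      subst he
      exact Prod.ext (Fin.ext (Nat.succ_injective (hp.symm.trans hp'))) rfl
    simpa using this
  have hB : B.card ≤ (T ×ˢ T).card := by
    refine Finset.card_le_card_of_injOn (fun p => (ℓ p.1, ℓ p.2))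
      (fun p _ => Finset.mem_coe.2 (Finset.mem_product.2 ⟨hmem _, hmem _⟩)) ?_
    rintro ⟨x, y⟩ hp ⟨x', y'⟩ hp' he
    simp only [B, Finset.coe_filter, Finset.mem_univ, true_and, Set.mem_ofPred_eq,
      Prod.mk.injEq] at hp hp' he
    obtain ⟨e1, e2⟩ := h.unique _ _ _ _ hp.1 hp'.1 hp.2 he.1 he.2
    exact Prod.ext (Fin.ext e1) (Fin.ext e2)
  have hE : (E.card : ℝ) ≤ (T ×ˢ T).card * M := by
    rw [Finset.card_eq_sum_card_fiberwise (f := fun p : Fin n × Fin n => (ℓ p.1, ℓ p.2))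
      (t := T ×ˢ T) (fun p _ => Finset.mem_coe.2 (Finset.mem_product.2 ⟨hmem _, hmem _⟩)),
      Nat.cast_sum, ← nsmul_eq_mul]
    refine Finset.sum_le_card_nsmul _ _ _ ?_
    rintro ⟨a, b⟩ hab
    obtain ⟨ha, hb⟩ := Finset.mem_product.1 hab
    by_cases hc : a ≠ b ∧ ¬ σ.Linked a b
    · have hcr : (crossing L.access n ℓ a b : ℝ) ≤ M := by
        by_contra hcr
        exact hc.2 (hlink a (hTn a ha) b (hTn b hb) hc.1 (not_le.1 hcr))
      refine le_trans ?_ hcr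
      refine Nat.cast_le.2 (card_crossing_le _ L.isGraph_access a b _ fun p hp => ?_)
      simp only [E, Finset.mem_filter, Finset.mem_univ, true_and, Prod.mk.injEq] at hp
      exact ⟨(L.access_adj _ _).2 hp.1.1, hp.2⟩
    · rw [Finset.card_eq_zero.2, Nat.cast_zero]
      · exact hM
      · refine Finset.filter_eq_empty_iff.2 fun p hp he => hc ?_
        simp only [E, Finset.mem_filter, Finset.mem_univ, true_and, Prod.mk.injEq] at hp he
        rw [← he.1, ← he.2]
        exact hp.2
  have hsub : (Finset.univ.filter fun p : Fin n × Fin n => H.Adj p.1 p.2) ⊆ A₁ ∪ A₂ ∪ B ∪ E := by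
    intro p hp
    have hp : H.Adj p.1 p.2 := by simpa using hp
    simp only [A₁, A₂, B, E, Finset.mem_union, Finset.mem_filter, Finset.mem_univ, true_and]
    obtain ⟨hadj, hq⟩ := hp
    by_cases he : ℓ p.1 = ℓ p.2
    · rcases hq with hq | hq
      · have := h.intra _ _ hq he
        tauto
      · exact absurd ⟨hall _ p.1.2, hall _ p.2.2, .inl he⟩ hq
    · rcases hq with hq | hq
      · tauto
      · have : ¬ σ.Linked (ℓ p.1) (ℓ p.2) :=
          fun hl => hq ⟨hall _ p.1.2, hall _ p.2.2, .inr hl⟩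
        tauto
  have hcard : H.edgeSet.ncard ≤ A₁.card + A₂.card + B.card + E.card := by
    refine (ncard_edgeSet_le H).trans ((Finset.card_le_card hsub).trans ?_)
    refine (Finset.card_union_le _ _).trans (add_le_add_left ?_ _)
    exact (Finset.card_union_le _ _).trans (add_le_add_left (Finset.card_union_le _ _) _)
  have hTT : ((T ×ˢ T).card : ℝ) ≤ ((σ.centers n).card : ℝ) ^ 2 := by
    rw [Finset.card_product, Nat.cast_mul, sq]
    have : (T.card : ℝ) ≤ (σ.centers n).card := by exact_mod_cast hTcard
    gcongr
  have hcard' : (H.edgeSet.ncard : ℝ) ≤ n + n + (T ×ˢ T).card + E.card := by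
    have : H.edgeSet.ncard ≤ n + n + (T ×ˢ T).card + E.card := by omega
    exact_mod_cast this
  nlinarith [mul_le_mul_of_nonneg_right hTT hM]

end Spanner

/-! ### The failure probability -/

theorem GraphAccess.IsGraph.card_adj {Γ : GraphAccess} {n : ℕ} (hΓ : Γ.IsGraph n) (v : ℕ) :
    ((Finset.range n).filter fun u => Γ.adj v u = true).card = Γ.deg v := by
  have himg : (Finset.range n).filter (fun u => Γ.adj v u = true) =
      (Finset.range (Γ.deg v)).image (Γ.nbr v) := by
    ext u
    simp only [Finset.mem_filter, Finset.mem_range, Finset.mem_image]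
    constructor
    · rintro ⟨-, h⟩
      exact hΓ.exists_nbr v u h
    · rintro ⟨i, hi, rfl⟩
      exact ⟨(hΓ.lt _ _ (hΓ.adj_nbr v i hi)).2, hΓ.adj_nbr v i hi⟩
  rw [himg, Finset.card_image_of_injOn, Finset.card_range]
  intro i hi j hj h
  exact hΓ.nbr_inj v i j (by simpa using hi) (by simpa using hj) h

/-- For the truncated probability `q ≤ p`, the mean is `1 + q (e - 1) ≤ 1 + 2 p ≤ exp (2 p)`, using
`e < 3`. -/
theorem coin_mgf_le {p : ℝ} (hp : 0 ≤ p) :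
    ((min p.toNNReal 1 : ℝ≥0) : ℝ≥0∞) * ENNReal.ofReal (Real.exp 1)
      + ((1 - min p.toNNReal 1 : ℝ≥0) : ℝ≥0∞) * 1 ≤ ENNReal.ofReal (Real.exp (2 * p)) := by
  have h1 : min p.toNNReal 1 ≤ 1 := min_le_right _ _
  have h2 : ((min p.toNNReal 1 : ℝ≥0) : ℝ) ≤ p := by
    calc ((min p.toNNReal 1 : ℝ≥0) : ℝ) ≤ (p.toNNReal : ℝ) := by exact_mod_cast min_le_left _ _
      _ = p := Real.coe_toNNReal p hp
  generalize min p.toNNReal 1 = q at h1 h2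
  have h3 : (0 : ℝ) ≤ q := q.coe_nonneg
  rw [mul_one, ← ENNReal.ofReal_coe_nnreal, ← ENNReal.ofReal_coe_nnreal, NNReal.coe_sub h1,
    ← ENNReal.ofReal_mul h3, ← ENNReal.ofReal_add (mul_nonneg h3 (Real.exp_pos _).le)
      (by simpa using h1)]
  refine ENNReal.ofReal_le_ofReal ?_
  have h4 := Real.exp_one_lt_d9
  have h5 := Real.add_one_le_exp (2 * p)
  rw [NNReal.coe_one]
  nlinarith [mul_le_mul_of_nonneg_left h4.le h3]

theorem coin_tails_le {p : ℝ} (hp : 0 ≤ p) :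
    ((1 - min p.toNNReal 1 : ℝ≥0) : ℝ≥0∞) ≤ ENNReal.ofReal (Real.exp (-p)) := by
  rw [← ENNReal.ofReal_coe_nnreal, NNReal.coe_sub (min_le_right _ _)]
  refine ENNReal.ofReal_le_ofReal ?_
  have h1 := Real.add_one_le_exp (-p)
  have h2 := Real.exp_pos (-p)
  rcases le_total p 1 with h | h
  · rw [min_eq_left (by simpa using h), Real.coe_toNNReal p hp, NNReal.coe_one]
    linarith
  · rw [min_eq_right (by simpa using h)]
    simpa using h2.le

/-- Chernoff's bound with exponent parameter 1: Markov's inequality for the exponential of the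
number of centres. -/
theorem runExpect_card_centers_le (Γ : GraphAccess) (n : ℕ) {p : ℝ} (hp : 0 ≤ p) (x : ℝ) :
    (runExpect Γ (chooseCenters n p) State.init fun τ =>
      if x < (τ.centers n).card then 1 else 0) ≤ ENNReal.ofReal (Real.exp (2 * p * n - x)) := by
  set g : ℕ → Bool → ℝ≥0∞ := fun _ b => if b then ENNReal.ofReal (Real.exp 1) else 1 with hg
  calc _ ≤ runExpect Γ (chooseCenters n p) State.init fun τ =>
          (∏ u ∈ Finset.range n, g u (decide (τ.lab u = u + 1))) *
            ENNReal.ofReal (Real.exp (-x)) := by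
        refine expect_mono fun y _ => ?_
        beta_reduce
        split_ifs with hx
        · have : ∏ u ∈ Finset.range n, g u (decide (y.1.lab u = u + 1)) =
              ENNReal.ofReal (Real.exp 1) ^ (y.1.centers n).card := by
            simp [hg, Finset.prod_ite, State.centers]
          rw [this, ← ENNReal.ofReal_pow (Real.exp_pos _).le, ← Real.exp_nat_mul, mul_one,
            ← ENNReal.ofReal_mul (Real.exp_pos _).le, ← Real.exp_add, ← ENNReal.ofReal_one]
          refine ENNReal.ofReal_le_ofReal (Real.one_le_exp ?_)
          linarith
        · exact zero_le
    _ = _ := expect_mul_right _ _ _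
    _ ≤ (ENNReal.ofReal (Real.exp (2 * p))) ^ n * ENNReal.ofReal (Real.exp (-x)) := by
        gcongr
        refine (runExpect_chooseCenters_prod Γ n p g).trans ?_
        refine (Finset.prod_le_pow_card _ _ _ fun u _ => ?_).trans (by rw [Finset.card_range])
        simpa [hg] using coin_mgf_le hp
    _ = _ := by
        rw [← ENNReal.ofReal_pow (Real.exp_pos _).le, ← Real.exp_nat_mul,
          ← ENNReal.ofReal_mul (Real.exp_pos _).le, ← Real.exp_add]
        congr 2
        ring

/-- No neighbour of `v` is a cluster centre. -/
def Isolated (Γ : GraphAccess) (v : ℕ) (σ : State) : Prop := ∀ u, Γ.adj v u → σ.lab u ≠ u + 1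

-- The indicator is bounded by a product over the vertices with value 0 at a neighbour that is a
-- centre; independence gives one tails probability per neighbour.
open Classical in
theorem runExpect_isolated_le {Γ : GraphAccess} {n : ℕ} (hΓ : Γ.IsGraph n) {p : ℝ} (hp : 0 ≤ p)
    (v : ℕ) : (runExpect Γ (chooseCenters n p) State.init fun τ =>
      if Isolated Γ v τ then 1 else 0) ≤ ENNReal.ofReal (Real.exp (-(p * Γ.deg v))) := by
  set g : ℕ → Bool → ℝ≥0∞ := fun u b => if Γ.adj v u && b then 0 else 1 with hg
  calc _ ≤ runExpect Γ (chooseCenters n p) State.init fun τ =>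
          ∏ u ∈ Finset.range n, g u (decide (τ.lab u = u + 1)) := by
        refine expect_mono fun y _ => ?_
        beta_reduce
        split_ifs with hy
        · refine (Finset.prod_eq_one fun u _ => ?_).ge
          have := hy u
          simp only [hg]
          rw [if_neg]
          simpa using this
        · exact zero_le
    _ ≤ _ := runExpect_chooseCenters_prod Γ n p g
    _ ≤ ∏ u ∈ Finset.range n, if Γ.adj v u = true then ENNReal.ofReal (Real.exp (-p)) else 1 := by
        refine Finset.prod_le_prod' fun u _ => ?_
        by_cases hu : Γ.adj v u = true
        · simpa [hg, hu] using coin_tails_le hp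
        · simp only [hg, hu, Bool.false_and, Bool.false_eq_true, if_false, mul_one]
          norm_cast
          rw [add_tsub_cancel_of_le (min_le_right _ _)]
    _ = _ := by
        rw [Finset.prod_ite, Finset.prod_const_one, mul_one, Finset.prod_const, hΓ.card_adj,
          ← ENNReal.ofReal_pow (Real.exp_pos _).le, ← Real.exp_nat_mul]
        congr 2
        ring

/-- The preprocessing algorithm for large degrees. -/
noncomputable def clusterProgram (n : ℕ) (p : ℝ) (m : ℕ) : Prog :=
  .seq (chooseCenters n p) (.seq (assignClusters n) (sampleEdges n m))

theorem State.centers_congr {n : ℕ} {σ τ : State} (h : ∀ u, τ.lab u = u + 1 ↔ σ.lab u = u + 1) :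
    τ.centers n = σ.centers n := by
  simp [State.centers, h]

theorem ensures_clusterProgram {Γ : GraphAccess} {n : ℕ} (hΓ : Γ.IsGraph n) (p : ℝ) (m : ℕ) :
    Ensures Γ (clusterProgram n p m) State.init fun τ t => ClusterOracle Γ n τ.lab τ ∧
      t ≤ 35 * n + 8 + 30 * ∑ c ∈ τ.centers n, Γ.deg c + 102 * (n * m) := by
  rw [clusterProgram, ensures_seq]
  refine (ensures_chooseCenters Γ n p).mono ?_
  rintro σ₁ t₁ ⟨h1, h2, h3, h4, ht₁⟩
  rw [ensures_seq]
  refine (ensures_assignClusters hΓ h1 h2 h3 h4).mono ?_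
  rintro σ₂ t₂ ⟨hs, -, ht₂⟩
  refine (ensures_sampleEdges hΓ ⟨hs.clusterOracle, fun u k => by simp [hs.perm]⟩ m).mono ?_
  rintro τ t₃ ⟨ho, ht₃⟩
  have hlab : τ.lab = σ₂.lab := funext ho.lab_eq
  rw [State.centers_congr (σ := σ₁) (n := n) (τ := τ) fun u => by rw [hlab]; exact hs.center_iff u]
  refine ⟨hlab ▸ ho, ?_⟩
  -- Here `35 = 12 + 20 + 3` collects the three linear terms, and 8 is made of three loop overheads
  -- of 2 and two sequencing steps.
  have : n * (102 * m + 3) = 102 * (n * m) + 3 * n := by ring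
  omega

/-- The rare events: there are more than `x` centres, a vertex has not been clustered, or two
clusters with more than `M` edges between them have not been recorded as adjacent. -/
def Failure (Γ : GraphAccess) (n : ℕ) (x M : ℝ) (τ : State) : Prop :=
  x < (τ.centers n).card ∨ (∃ u < n, τ.lab u = 0) ∨
    ∃ a ∈ Finset.Icc 1 n, ∃ b ∈ Finset.Icc 1 n, a ≠ b ∧ M < crossing Γ n τ.lab a b ∧
      ¬ τ.Linked a b

-- A union bound, conditioned on the state after each step. An unclustered vertex must be isolated,
-- since the second step clusters all neighbours of centres.
open Classical in
theorem runExpect_failure_le {Γ : GraphAccess} {n : ℕ} (hΓ : Γ.IsGraph n) {p : ℝ} (hp : 0 ≤ p)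
    {m : ℕ} {x M d e : ℝ} (hd0 : 0 < d) (hd : ∀ v < n, (Γ.deg v : ℝ) ≤ d)
    (he₁ : ∀ v < n, e ≤ p * Γ.deg v) (he₂ : e ≤ m * M / d) :
    (runExpect Γ (clusterProgram n p m) State.init fun τ => if Failure Γ n x M τ then 1 else 0) ≤
      ENNReal.ofReal (Real.exp (2 * p * n - x)) + n * ENNReal.ofReal (Real.exp (-e))
        + (n * n : ℕ) * ENNReal.ofReal (Real.exp (-e)) := by
  set ε := ENNReal.ofReal (Real.exp (-e)) with hε
  set F₁ : State → ℝ≥0∞ := fun σ => (if x < (σ.centers n).card then 1 else 0) +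
    ∑ v ∈ Finset.range n, if Isolated Γ v σ then 1 else 0 with hF₁
  have hstep3 : ∀ σ₁ : State, (∀ u, σ₁.lab u = 0 ∨ σ₁.lab u = u + 1) →
      (∀ u w, σ₁.arr .edge u w = 0) → (∀ u w, σ₁.arr .pair u w = 0) →
      (∀ u w, σ₁.arr .perm u w = 0) →
      runExpect Γ (.seq (assignClusters n) (sampleEdges n m)) σ₁
        (fun τ => if Failure Γ n x M τ then 1 else 0) ≤ F₁ σ₁ + (n * n : ℕ) * ε := by
    intro σ₁ h1 h2 h3 h4
    rw [runExpect_seq]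
    refine runExpect_le (ensures_assignClusters hΓ h1 h2 h3 h4) ?_
    rintro σ₂ t₂ ⟨hs, hcov, -⟩
    have hsam : Sampling Γ n σ₂.lab σ₂ := ⟨hs.clusterOracle, fun u k => by simp [hs.perm]⟩
    -- Labels are final before sampling begins, so the set of pairs that must be found does not
    -- depend on the draws.
    set S := (Finset.Icc 1 n ×ˢ Finset.Icc 1 n).filter fun q : ℕ × ℕ =>
      q.1 ≠ q.2 ∧ M < crossing Γ n σ₂.lab q.1 q.2 with hS
    have hScard : S.card ≤ n * n := by
      refine (Finset.card_filter_le _ _).trans ?_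
      simp
    calc _ ≤ runExpect Γ (sampleEdges n m) σ₂ fun τ =>
            F₁ σ₁ + ∑ q ∈ S, unlinked q.1 q.2 τ := by
          refine runExpect_mono (ensures_sampleEdges hΓ hsam m) ?_
          rintro τ t ⟨ho, -⟩
          have hlab : τ.lab = σ₂.lab := funext ho.lab_eq
          split_ifs with hbad
          swap
          · exact zero_le
          rcases hbad with hb | ⟨u, hu, hb⟩ | ⟨a, ha, b, hb, hab, hM, hl⟩
          · rw [State.centers_congr (σ := σ₁) (n := n) (τ := τ) fun u => by
              rw [hlab]; exact hs.center_iff u] at hb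
            simp only [hF₁, hb, if_true, add_assoc]
            exact le_self_add
          · have hiso : Isolated Γ u σ₁ := by
              intro c huc hc
              rw [hlab] at hb
              exact hcov c (hΓ.lt _ _ huc).2 hc u (hΓ.symm _ _ huc) hb
            have h5 := Finset.single_le_sum (f := fun v => if Isolated Γ v σ₁ then (1 : ℝ≥0∞) else 0)
              (fun _ _ => zero_le) (Finset.mem_range.2 hu)
            simp only [hiso, if_true] at h5
            exact h5.trans (le_add_self.trans le_self_add)
          · have hq : (a, b) ∈ S := by
              rw [hlab] at hM
              exact Finset.mem_filter.2 ⟨Finset.mem_product.2 ⟨ha, hb⟩, hab, hM⟩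
            have h5 := Finset.single_le_sum (f := fun q : ℕ × ℕ => unlinked q.1 q.2 τ)
              (fun _ _ => zero_le) hq
            simp only [unlinked, hl, if_false] at h5
            exact h5.trans le_add_self
      _ = F₁ σ₁ + ∑ q ∈ S, runExpect Γ (sampleEdges n m) σ₂ (unlinked q.1 q.2) := by
          rw [runExpect, expect_add, expect_const, expect_sum]
          rfl
      _ ≤ F₁ σ₁ + ∑ q ∈ S, ε := by
          gcongr with q hq
          obtain ⟨hq1, hne, hM⟩ := Finset.mem_filter.1 hq
          obtain ⟨ha, hb⟩ := Finset.mem_product.1 hq1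
          rw [Finset.mem_Icc] at ha hb
          refine (runExpect_sampleEdges_le hΓ hsam hs.perm m (by omega) (by omega) hne hd).trans ?_
          refine ENNReal.ofReal_le_ofReal (Real.exp_le_exp.2 (neg_le_neg (he₂.trans ?_)))
          gcongr
      _ ≤ F₁ σ₁ + (n * n : ℕ) * ε := by
          rw [Finset.sum_const, nsmul_eq_mul]
          gcongr
  rw [clusterProgram, runExpect_seq]
  calc _ ≤ runExpect Γ (chooseCenters n p) State.init fun σ₁ => F₁ σ₁ + (n * n : ℕ) * ε := by
        refine runExpect_mono (ensures_chooseCenters Γ n p) ?_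
        rintro σ₁ t ⟨h1, h2, h3, h4, -⟩
        exact hstep3 σ₁ h1 h2 h3 h4
    _ = (runExpect Γ (chooseCenters n p) State.init fun σ =>
          if x < (σ.centers n).card then 1 else 0) +
        ∑ v ∈ Finset.range n, (runExpect Γ (chooseCenters n p) State.init fun σ =>
          if Isolated Γ v σ then 1 else 0) + (n * n : ℕ) * ε := by
        simp only [runExpect, hF₁, expect_add, expect_const, expect_sum]
    _ ≤ _ := by
        gcongr
        · exact runExpect_card_centers_le Γ n hp x
        · calc _ ≤ ∑ v ∈ Finset.range n, ε := by
                refine Finset.sum_le_sum fun v hv => (runExpect_isolated_le hΓ hp v).trans ?_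
                exact ENNReal.ofReal_le_ofReal (Real.exp_le_exp.2
                  (neg_le_neg (he₁ v (Finset.mem_range.1 hv))))
            _ = n * ε := by rw [Finset.sum_const, nsmul_eq_mul, Finset.card_range]

/-! ### The two regimes of the construction -/

section Final
variable {n : ℕ} {G : SimpleGraph (Fin n)} [DecidableRel G.Adj] (L : AdjacencyLists G)

theorem successProb_mono {C D r e₁ e₂ t₁ t₂ q₁ q₂ : ℝ} (he : e₁ ≤ e₂) (ht : t₁ ≤ t₂)
    (hq : q₁ ≤ q₂) : successProb L C D r e₁ t₁ q₁ ≤ successProb L C D r e₂ t₂ q₂ := by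
  refine MeasureTheory.measure_mono ?_
  rintro x ⟨h1, H, h2, ⟨h3, h4, h5⟩, h6⟩
  exact ⟨h1.trans ht, H, h2, ⟨h3, h4, h5.trans hq⟩, h6.trans he⟩

theorem ApproxRegular.edges_le {C D : ℝ} (h : ApproxRegular G C D) :
    (G.edgeSet.ncard : ℝ) ≤ n * (C * D) := by
  have h1 : (Finset.univ.filter fun p : Fin n × Fin n => G.Adj p.1 p.2).card =
      ∑ v, G.degree v := by
    rw [← Finset.univ_product_univ, Finset.card_filter, Finset.sum_product]
    refine Finset.sum_congr rfl fun v _ => ?_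
    rw [← Finset.card_filter, ← SimpleGraph.card_neighborFinset_eq_degree,
      SimpleGraph.neighborFinset_eq_filter]
  have h2 : (G.edgeSet.ncard : ℝ) ≤ ∑ v, (G.degree v : ℝ) := by
    exact_mod_cast (ncard_edgeSet_le G).trans h1.le
  refine h2.trans ((Finset.sum_le_card_nsmul _ _ _ fun v _ => (h v).2).trans ?_)
  simp

/-- For small degrees the graph itself is used. -/
theorem successProb_eq_one_of_lt {C D r e t q : ℝ} (hD : D < (n : ℝ) ^ (1 / 3 : ℝ))
    (he : (G.edgeSet.ncard : ℝ) ≤ e) (ht : 1 ≤ t) (hq : 10 ≤ q) :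
    successProb L C D r e t q = 1 := by
  classical
  rw [successProb, preprocess, if_pos hD, toOuterMeasure_eq_expect, Prog.run, expect_pure, if_pos]
  refine ⟨by simpa using ht, G, IsSpanner.refl G (by norm_num), ?_, he⟩
  rw [query, if_pos hD]
  refine ⟨fun s t => ?_, fun s t hst => by simp [Cond.eval, hst], ?_⟩
  · simp [guarded, Cond.eval, Expr.eval, State.withQuery, L.access_adj]
  · refine le_trans ?_ hq
    norm_num [guarded, Cond.cost, Expr.cost]

/-! ### Numerical bounds: query cost, failure probability, time and edges. -/

theorem cast_guarded_clusterQuery_cost_le : ((guarded clusterQuery).cost : ℝ) ≤ 100 := by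
  norm_num [guarded, clusterQuery, Cond.cost, Expr.cost, bothClustered, label]

/-- Each of the three terms of the union bound will be at most `n ^ 2 * n ^ (-100)`. -/
theorem three_mul_sq_mul_exp_le (hn : 2 ≤ n) :
    3 * (n : ℝ) ^ 2 * Real.exp (-(100 * Real.log n)) ≤ 1 / n := by
  have hn' : (2 : ℝ) ≤ n := by exact_mod_cast hn
  have h0 : (0 : ℝ) < n := by linarith
  have h1 : Real.exp (-(100 * Real.log n)) = ((n : ℝ) ^ 100)⁻¹ := by
    rw [Real.exp_neg, show (100 : ℝ) * Real.log n = (100 : ℕ) * Real.log n by norm_num,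
      Real.exp_nat_mul, Real.exp_log h0]
  rw [h1, ← div_eq_mul_inv, div_le_div_iff₀ (by positivity) h0, one_mul]
  calc 3 * (n : ℝ) ^ 2 * n ≤ (n : ℝ) ^ 2 * (n : ℝ) ^ 2 * n := by gcongr; nlinarith
    _ = (n : ℝ) ^ 5 := by ring
    _ ≤ (n : ℝ) ^ 100 := pow_le_pow_right₀ (by linarith) (by norm_num)

/-- Here `x` stands for `n` and `k` for the number of centres, so `k * (C * D)` bounds the total
degree of the centres. -/
theorem time_bound {C lg x r k D m : ℝ} (hC : 1 ≤ C) (hlg : 0 ≤ lg) (hx : 1 ≤ x) (hr : 0 ≤ r)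
    (hkD : k * D ≤ 300 * C * lg * x) (hm : m ≤ 100 * C * r * lg + 1) :
    35 * x + 8 + 30 * (k * (C * D)) + 102 * (x * m) ≤
      200000 * C ^ 3 * (1 + lg) ^ 2 * (max r 1 * x) := by
  have hC0 : 0 < C := by linarith
  have hC3 : 1 ≤ C ^ 3 := one_le_pow₀ hC
  have hC2 : C ^ 2 ≤ C ^ 3 := pow_le_pow_right₀ hC (by norm_num)
  have hC1 : C ≤ C ^ 3 := le_self_pow₀ hC (by norm_num)
  have hlg2 : 1 + lg ≤ (1 + lg) ^ 2 := le_self_pow₀ (by linarith) (by norm_num)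
  obtain ⟨R, hR⟩ : ∃ R, R = max r 1 := ⟨_, rfl⟩
  rw [← hR]
  have hR1 : 1 ≤ R := hR ▸ le_max_right _ _
  have hRr : r ≤ R := hR ▸ le_max_left _ _
  have hR0 : 0 ≤ R := by linarith
  have hx0 : 0 ≤ x := by linarith
  have h1 : x ≤ R * x := le_mul_of_one_le_left hx0 hR1
  have h2 : k * (C * D) ≤ 300 * (C ^ 3 * lg * (R * x)) := by
    calc k * (C * D) = C * (k * D) := by ring
      _ ≤ C * (300 * C * lg * x) := by gcongr
      _ = 300 * (C ^ 2 * lg * x) := by ring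
      _ ≤ _ := by gcongr
  have h3 : x * m ≤ 100 * (C ^ 3 * lg * (R * x)) + R * x := by
    calc x * m ≤ x * (100 * C * r * lg + 1) := by gcongr
      _ ≤ x * (100 * C ^ 3 * R * lg + R) := by gcongr
      _ = _ := by ring
  have h5 : 1 * (R * x) ≤ C ^ 3 * (R * x) := by gcongr
  have h6 : 0 ≤ C ^ 3 * lg * (R * x) := by positivity
  calc _ ≤ 200000 * C ^ 3 * (1 + lg) * (R * x) := by linarith
    _ ≤ _ := by gcongr

/-- The hypothesis `r ≤ C D` gives `1 + D / r ≤ 2 C D / r`, so the recorded pairs cost no more than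
the unlinked ones; the constant is `180000 = 2 * 300 ^ 2`. -/
theorem edges_bound {C lg x r k D : ℝ} (hC : 1 ≤ C) (hlg : 0 ≤ lg) (hx : 0 ≤ x) (hD : 0 < D)
    (hr : 0 < r) (hrD : r ≤ C * D) (hk : 0 ≤ k) (hkD : k * D ≤ 300 * C * lg * x) :
    2 * x + k ^ 2 * (1 + D / r) ≤
      200000 * C ^ 3 * (1 + lg) ^ 2 * (x + x ^ 2 / (D * r)) := by
  have hC0 : 0 < C := by linarith
  have hC3 : 1 ≤ C ^ 3 := one_le_pow₀ hC
  have hlg2 : 1 ≤ (1 + lg) ^ 2 := one_le_pow₀ (by linarith)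
  have hDC : D ≤ C * D := le_mul_of_one_le_left hD.le hC
  have h2 : k ^ 2 * (1 + D / r) ≤ 180000 * C ^ 3 * lg ^ 2 * (x ^ 2 / (D * r)) := by
    calc k ^ 2 * (1 + D / r) = (k * D) ^ 2 * (r + D) / (D ^ 2 * r) := by field_simp
      _ ≤ (300 * C * lg * x) ^ 2 * (2 * C * D) / (D ^ 2 * r) := by
          gcongr
          linarith
      _ = _ := by field_simp; ring
  have h3 : lg ^ 2 ≤ (1 + lg) ^ 2 := by gcongr; linarith
  have h4 : 0 ≤ x ^ 2 / (D * r) := by positivity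
  have h5 : 1 ≤ C ^ 3 * (1 + lg) ^ 2 := one_le_mul_of_one_le_of_one_le hC3 hlg2
  calc 2 * x + k ^ 2 * (1 + D / r)
      ≤ 2 * x + 180000 * C ^ 3 * lg ^ 2 * (x ^ 2 / (D * r)) := by linarith
    _ ≤ 200000 * (C ^ 3 * (1 + lg) ^ 2) * x +
          200000 * C ^ 3 * (1 + lg) ^ 2 * (x ^ 2 / (D * r)) := by
        gcongr
        · linarith
        · norm_num
    _ = _ := by ring

theorem le_successProb_of_le {C D r : ℝ} (hn : 2 ≤ n) (hC : 1 ≤ C) (hreg : ApproxRegular G C D)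
    (hD : (n : ℝ) ^ (1 / 3 : ℝ) ≤ D) (hr : 0 < r) (hrD : r ≤ C * D) :
    ENNReal.ofReal (1 - 1 / n) ≤ successProb L C D r
      (200000 * C ^ 3 * (1 + Real.log n) ^ 2 * (n + (n : ℝ) ^ 2 / (D * r)))
      (200000 * C ^ 3 * (1 + Real.log n) ^ 2 * (max r 1 * n))
      (200000 * C ^ 3 * (1 + Real.log n) ^ 2) := by
  classical
  have hn' : (2 : ℝ) ≤ n := by exact_mod_cast hn
  have hn0 : (0 : ℝ) < n := by linarith
  have hC0 : 0 < C := by linarith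
  have hD0 : 0 < D := (Real.rpow_pos_of_pos hn0 _).trans_le hD
  set lg := Real.log n with hlg
  have hlg0 : 0 ≤ lg := Real.log_nonneg (by linarith)
  have hC3 : 1 ≤ C ^ 3 := one_le_pow₀ hC
  have hlg2 : 1 + lg ≤ (1 + lg) ^ 2 := le_self_pow₀ (by linarith) (by norm_num)
  have hdeg : ∀ v < n, D / C ≤ L.access.deg v ∧ (L.access.deg v : ℝ) ≤ C * D := by
    intro v hv
    have := hreg ⟨v, hv⟩
    rwa [← L.access_deg ⟨v, hv⟩] at this
  -- Degrees are below `n`; this yields `p n ≥ 100 log n`, which the concentration of the number of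
  -- centres needs.
  have hDn : D ≤ C * n := by
    have h1 := (hreg ⟨0, by omega⟩).1
    have h2 : (G.degree ⟨0, by omega⟩ : ℝ) ≤ n := by
      have := (G.degree_lt_card_verts ⟨0, by omega⟩).le
      rw [Fintype.card_fin] at this
      exact_mod_cast this
    rw [div_le_iff₀ hC0] at h1
    nlinarith
  set p := 100 * C * lg / D with hp
  set m := ⌈100 * C * r * lg⌉₊ with hm
  have hp0 : 0 ≤ p := by positivity
  have hm₁ : 100 * C * r * lg ≤ m := Nat.le_ceil _
  have hm₂ : (m : ℝ) ≤ 100 * C * r * lg + 1 := (Nat.ceil_lt_add_one (by positivity)).le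
  have hpn : 100 * lg ≤ p * n := by
    rw [hp, div_mul_eq_mul_div, le_div_iff₀ hD0]
    nlinarith [mul_le_mul_of_nonneg_left hDn hlg0]
  -- The threshold `3 p n` leaves the exponent `2 p n - 3 p n = -p n ≤ -100 log n`. The choices `M =
  -- D / r` and `d = C D` make `m M / d` at least `100 log n`.
  have hfail := runExpect_failure_le L.isGraph_access hp0 (m := m) (x := 3 * p * n) (M := D / r)
    (d := C * D) (e := 100 * lg) (by positivity) (fun v hv => (hdeg v hv).2)
    (fun v hv => by
      calc 100 * lg = p * (D / C) := by rw [hp]; field_simp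
        _ ≤ _ := mul_le_mul_of_nonneg_left (hdeg v hv).1 hp0)
    (by
      calc 100 * lg = 100 * C * r * lg * (D / r) / (C * D) := by field_simp
        _ ≤ _ := by gcongr)
  rw [successProb, preprocess, if_neg (not_lt.2 hD), query, if_neg (not_lt.2 hD)]
  change _ ≤ PMF.toOuterMeasure (Prog.run L.access (clusterProgram n p m) State.init) _
  rw [ENNReal.ofReal_sub _ (by positivity), ENNReal.ofReal_one]
  refine le_toOuterMeasure_of_expect_compl_le
    (f := fun y => if Failure L.access n (3 * p * n) (D / r) y.1 then 1 else 0) ?_ ?_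
  · rintro ⟨τ, t⟩ hy hbad
    obtain ⟨ho, ht⟩ := ensures_clusterProgram L.isGraph_access p m _ hy
    dsimp only at ho ht ⊢
    by_contra hF
    have hF : ¬ Failure L.access n (3 * p * n) (D / r) τ := fun h => hF (by rw [if_pos h])
    rw [Failure] at hF
    push Not at hF
    obtain ⟨hk, hall, hlink⟩ := hF
    set k : ℝ := ((τ.centers n).card : ℝ) with hk'
    have hk0 : 0 ≤ k := Nat.cast_nonneg _
    have hkD : k * D ≤ 300 * C * lg * n := by
      calc k * D ≤ 3 * p * n * D := by gcongr
        _ = _ := by rw [hp]; field_simp; ring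
    refine hbad ⟨?_, oracleGraph G τ.lab τ ho, isSpanner_oracleGraph ho, ?_, ?_⟩
    · have hS : ((∑ c ∈ τ.centers n, L.access.deg c : ℕ) : ℝ) ≤ k * (C * D) := by
        push_cast
        rw [hk', ← nsmul_eq_mul]
        refine Finset.sum_le_card_nsmul _ _ _ fun c hc => ?_
        exact (hdeg c (Finset.mem_range.1 (Finset.mem_filter.1 hc).1)).2
      have ht' : (t : ℝ) ≤ 35 * n + 8 + 30 * (k * (C * D)) + 102 * (n * m) := by
        have : (t : ℝ) ≤ 35 * n + 8 + 30 * ((∑ c ∈ τ.centers n, L.access.deg c : ℕ) : ℝ)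
            + 102 * (n * m) := by exact_mod_cast ht
        linarith
      exact ht'.trans (time_bound hC hlg0 (by linarith) hr.le hkD hm₂)
    · obtain ⟨h1, h2, h3⟩ := isAdjacencyOracle_oracleGraph (G := G) ho
      refine ⟨h1, h2, cast_guarded_clusterQuery_cost_le.trans ?_⟩
      have : 1 ≤ C ^ 3 * (1 + lg) ^ 2 := one_le_mul_of_one_le_of_one_le hC3 (by linarith)
      linarith
    · have h1 := ncard_oracleGraph_le (G := G) ho (fun u hu => hall u hu) (M := D / r)
        (by positivity) hlink
      refine h1.trans ?_
      exact edges_bound hC hlg0 hn0.le hD0 hr hrD hk0 hkD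
  · refine hfail.trans ?_
    have h1 : Real.exp (2 * p * n - 3 * p * n) ≤ Real.exp (-(100 * lg)) :=
      Real.exp_le_exp.2 (by linarith)
    have h2 := three_mul_sq_mul_exp_le hn
    have h0 := (Real.exp_pos (-(100 * lg))).le
    rw [← ENNReal.ofReal_natCast, ← ENNReal.ofReal_natCast, ← ENNReal.ofReal_mul (by positivity),
      ← ENNReal.ofReal_mul (by positivity), ← ENNReal.ofReal_add (Real.exp_pos _).le (by positivity),
      ← ENNReal.ofReal_add (by positivity) (by positivity)]
    refine ENNReal.ofReal_le_ofReal (le_trans ?_ h2)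
    push_cast
    have h3 : 1 * Real.exp (-(100 * lg)) ≤ (n : ℝ) ^ 2 * Real.exp (-(100 * lg)) := by
      gcongr; nlinarith
    have h4 : (n : ℝ) * Real.exp (-(100 * lg)) ≤ (n : ℝ) ^ 2 * Real.exp (-(100 * lg)) := by
      gcongr; nlinarith
    nlinarith

theorem cube_le_of_lt_rpow {D : ℝ} (h0 : 0 ≤ D) (hD : D < (n : ℝ) ^ (1 / 3 : ℝ)) :
    D ^ 3 ≤ n := by
  calc D ^ (3 : ℕ) ≤ ((n : ℝ) ^ (1 / 3 : ℝ)) ^ (3 : ℕ) := by gcongr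
    _ = n := by
      rw [← Real.rpow_natCast, ← Real.rpow_mul (Nat.cast_nonneg n)]
      norm_num

end Final

end SpannerOracle

/-! ### The theorem and its corollary from the two regimes. -/

theorem mainTheorem8 :
    ∃ (c : ℝ) (a : ℕ), 0 < c ∧ ∀ C : ℝ, 1 ≤ C → ∃ K : ℝ, 0 < K ∧
      ∀ (n : ℕ) (G : SimpleGraph (Fin n)) [DecidableRel G.Adj]
        (L : SpannerOracle.AdjacencyLists G) (D : ℝ),
        1 ≤ n → SpannerOracle.ApproxRegular G C D →
        (∀ r : ℝ, 0 < r → r ≤ C * D →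
          ENNReal.ofReal (1 - 1 / (n : ℝ) ^ c) ≤
            SpannerOracle.successProb L C D r
              (K * (1 + Real.log n) ^ a * (n + (n : ℝ) ^ 2 / (D * r)))
              (K * (1 + Real.log n) ^ a * (max r 1 * n))
              (K * (1 + Real.log n) ^ a)) ∧
        ENNReal.ofReal (1 - 1 / (n : ℝ) ^ c) ≤
          SpannerOracle.successProb L C D ((n : ℝ) ^ (1 / 3 : ℝ))
            (K * (1 + Real.log n) ^ a * (n : ℝ) ^ (4 / 3 : ℝ))
            (K * (1 + Real.log n) ^ a * (n : ℝ) ^ (4 / 3 : ℝ))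
            (K * (1 + Real.log n) ^ a) := by
  open SpannerOracle in
  -- The constant is twice that of `le_successProb_of_le`, because the corollary bounds a sum of two
  -- terms by `2 n ^ (4/3)`.
  refine ⟨1, 2, one_pos, fun C hC => ⟨400000 * C ^ 3, by positivity, ?_⟩⟩
  intro n G _ L D hn hreg
  rw [Real.rpow_one]
  rcases Nat.eq_or_lt_of_le hn with rfl | hn2
  -- For `n = 1` the required probability is 0.
  · simp
  have hn' : (2 : ℝ) ≤ n := by exact_mod_cast hn2
  have hn0 : (0 : ℝ) < n := by linarith
  have hC0 : 0 < C := by linarith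
  have hlg0 : 0 ≤ Real.log n := Real.log_nonneg (by linarith)
  have hCD : 0 ≤ C * D := (Nat.cast_nonneg _).trans (hreg ⟨0, by omega⟩).2
  have hD0 : 0 ≤ D := nonneg_of_mul_nonneg_right hCD hC0
  set B := 400000 * C ^ 3 * (1 + Real.log n) ^ 2 with hB
  have hB' : 200000 * C ^ 3 * (1 + Real.log n) ^ 2 * 2 = B := by rw [hB]; ring
  have hC3 : 1 ≤ C ^ 3 := one_le_pow₀ hC
  have hlg2 : 1 ≤ (1 + Real.log n) ^ 2 := one_le_pow₀ (by linarith)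
  have hBC : 400000 * C ^ 3 ≤ B := le_mul_of_one_le_right (by positivity) hlg2
  have hone : ENNReal.ofReal (1 - 1 / (n : ℝ)) ≤ 1 := by
    rw [← ENNReal.ofReal_one]
    exact ENNReal.ofReal_le_ofReal (by have : 0 ≤ 1 / (n : ℝ) := by positivity
                                       linarith)
  have h43 : (n : ℝ) ^ (4 / 3 : ℝ) = n ^ (1 / 3 : ℝ) * n := by
    rw [show (4 / 3 : ℝ) = 1 / 3 + 1 by norm_num, Real.rpow_add hn0, Real.rpow_one]
  have hroot : 1 ≤ (n : ℝ) ^ (1 / 3 : ℝ) := Real.one_le_rpow (by linarith) (by norm_num)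
  have hedges := hreg.edges_le
  rcases lt_or_ge D ((n : ℝ) ^ (1 / 3 : ℝ)) with hD | hD
  · have hD3 := cube_le_of_lt_rpow hD0 hD
    refine ⟨fun r hr hrD => ?_, ?_⟩
    · have hDpos : 0 < D := by
        by_contra h
        have : D = 0 := le_antisymm (not_lt.1 h) hD0
        rw [this, mul_zero] at hrD
        linarith
      refine hone.trans (successProb_eq_one_of_lt L hD (hedges.trans ?_) ?_ ?_).ge
      -- From `r ≤ C D` and `D ^ 3 ≤ n` one gets `D * (D r) ≤ C n`: here the trivial bound on the
      -- edges of `G` is already good enough.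
      · have h1 : n * (C * D) ≤ C ^ 2 * ((n : ℝ) ^ 2 / (D * r)) := by
          rw [mul_div_assoc', le_div_iff₀ (by positivity)]
          calc n * (C * D) * (D * r) ≤ n * (C * D) * (D * (C * D)) := by gcongr
            _ = C ^ 2 * n * D ^ 3 := by ring
            _ ≤ C ^ 2 * n * n := by gcongr
            _ = _ := by ring
        have h2 : C ^ 2 ≤ B := (pow_le_pow_right₀ hC (by norm_num : 2 ≤ 3)).trans (by linarith)
        have h3 : 0 ≤ (n : ℝ) ^ 2 / (D * r) := by positivity
        calc n * (C * D) ≤ C ^ 2 * ((n : ℝ) ^ 2 / (D * r)) := h1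
          _ ≤ B * (n + (n : ℝ) ^ 2 / (D * r)) := by gcongr; linarith
      · have h1 : 1 * 1 ≤ max r 1 * n := by gcongr; exacts [le_max_right _ _, by linarith]
        nlinarith
      · linarith
    · refine hone.trans (successProb_eq_one_of_lt L hD (hedges.trans ?_) ?_ ?_).ge
      · rw [h43]
        have h2 : C ≤ B := (le_self_pow₀ hC (by norm_num : 3 ≠ 0)).trans (by linarith)
        calc n * (C * D) = C * (D * n) := by ring
          _ ≤ B * (n ^ (1 / 3 : ℝ) * n) := by gcongr
      · have h1 : 1 * 1 ≤ (n : ℝ) ^ (1 / 3 : ℝ) * n := by gcongr; linarith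
        rw [h43]
        nlinarith
      · linarith
  · have hDpos : 0 < D := by linarith
    refine ⟨fun r hr hrD => (le_successProb_of_le L hn2 hC hreg hD hr hrD).trans
      (successProb_mono L ?_ ?_ ?_), (le_successProb_of_le L hn2 hC hreg hD (by linarith)
        (hD.trans (le_mul_of_one_le_left hD0 hC))).trans (successProb_mono L ?_ ?_ ?_)⟩
    · gcongr
      linarith
    · gcongr
      linarith
    · linarith
    · have h1 : (n : ℝ) + n ^ 2 / (D * n ^ (1 / 3 : ℝ)) ≤ 2 * n ^ (4 / 3 : ℝ) := by
        -- In this regime `D r ≥ n ^ (2/3)`. Also `r = n ^ (1/3) ≤ D ≤ C D`, so the corollary needs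
        -- no further condition on `D`.
        have h2 : (n : ℝ) ^ 2 / (D * n ^ (1 / 3 : ℝ)) ≤ n ^ (4 / 3 : ℝ) := by
          rw [div_le_iff₀ (by positivity), h43]
          have h3 : ((n : ℝ) ^ (1 / 3 : ℝ)) ^ 3 = n := by
            rw [← Real.rpow_natCast, ← Real.rpow_mul hn0.le]
            norm_num
          calc (n : ℝ) ^ 2 = ((n : ℝ) ^ (1 / 3 : ℝ)) ^ 3 * (n : ℝ) := by rw [h3]; ring
            _ = (n : ℝ) ^ (1 / 3 : ℝ) * n * ((n : ℝ) ^ (1 / 3 : ℝ) * (n : ℝ) ^ (1 / 3 : ℝ)) := by ring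
            _ ≤ (n : ℝ) ^ (1 / 3 : ℝ) * n * (D * (n : ℝ) ^ (1 / 3 : ℝ)) := by gcongr
        have h4 : (n : ℝ) ≤ n ^ (4 / 3 : ℝ) := by rw [h43]; nlinarith
        linarith
      calc _ ≤ 200000 * C ^ 3 * (1 + Real.log n) ^ 2 * (2 * n ^ (4 / 3 : ℝ)) := by gcongr
        _ = _ := by rw [← hB']; ring
    · rw [max_eq_left hroot, h43]
      gcongr
      linarith
    · linarith
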